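/- **Conventions.** A domain is a nonempty connected open set. Let $\alpha\in(0,1]$, $k>0$, $\sigma_0>0$. A domain $D\subset\mathbb R^3$ is uniformly $C^{1,\alpha}$ with constants $k,\sigma_0$ if for every $x_0\in\partial D$ there is an isometry $\mathcal R$ of $\mathbb R^3$ with $\mathcal R(0)=x_0$ such that the image under $\mathcal R$ of $$\{y: k|y'|^{1+\alpha}<|y_3|<k\sigma_0^{1+\alpha},\ |y'|<\sigma_0\},\qquad y'=(y_1,y_2),$$ does not meet $\partial D$, and $D$ lies on one side: the image of the part with $y_3>0$ is contained in $D$, and the image of the part with $y_3<0$ is disjoint from $D$. Let $\Omega\subset\mathbb R^3$ be a domain, $S\subset\Omega$ a bounded domain, $F=\Omega\setminus\overline S$, and $h=\operatorname{dist}(S,\partial\Omega)>0$. Let $P\in\partial S$, $Q\in\partial\Omega$ be points with $|PQ|=h$. Use orthogonal coordinates $(x',x_3)$, $x'=(x_1,x_2)$, with origin $Q$ in which $P=(0,0,h)$. For $\sigma>0$ let $$\mathcal C_\sigma=\{x: |x'|<\sigma,\ -k\sigma^{1+\alpha}<x_3<h+2k\sigma^{1+\alpha}\}.$$ For $1\le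 p<\infty$, $W^{1,p}_0(S,\Omega)$ is the set of vector fields $u\in W^{1,p}_0(\Omega;\mathbb R^3)$ (the closure of $C_c^\infty(\Omega;\mathbb R^3)$ in $W^{1,p}$) for which there are $u_*,\omega\in\mathbb R^3$ and $x_*\in\overline S$ with $u(x)=u_*+\omega\times(x-x_*)$ for $x\in S$. Put $u_P=u_*+\omega\times(P-x_*)$, and write $u_P=(u_{P\tau},u_{P3})$, $\omega=(\omega_\tau,\omega_3)$ in the above coordinates, where $\tau$ denotes the first two components. **Theorem.** Let $\alpha\in(0,1]$, $1\le p<\infty$ and $k,\sigma_0,H>0$. There are positive constants $H_*$, $C_w$, $c_0$, depending only on $\alpha,p,k,\sigma_0,H$, such that the following holds. Let $\Omega$ and $S$ be as above, both uniformly $C^{1,\alpha}$ with constants $k,\sigma_0$, with $\operatorname{diam}S=H$ and $0<h<H_*$, and let $u\in W^{1,p}_0(S,\Omega)$ satisfy $\operatorname{div}u=0$ in $\Omega$. Then, with $\sigma_h=c_0h^{\frac1{1+\alpha}}$, $$|u_{P3}|\le C_w\,h^{\frac{1+2\alpha}{p(1+\alpha)}\left(p-\frac{3+\alpha}{1+2\alpha}\right)}\|\nabla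 u\|_{L^p(\mathcal C_{\sigma_h}\cap F)},$$ $$|u_{P\tau}|\le C_w\,h^{\frac1p\left(p-\frac{3+\alpha}{1+\alpha}\right)}\|\nabla u\|_{L^p(\mathcal C_{\sigma_h}\cap F)},$$ $$|\omega_\tau|\le C_w\,h^{\frac{2\alpha}{p(1+\alpha)}\left(p-\frac{3+\alpha}{2\alpha}\right)}\|\nabla u\|_{L^p(\mathcal C_{\sigma_h}\cap F)},$$ $$|\omega_3|\le C_w\,h^{\frac{\alpha}{p(1+\alpha)}\left(p-\frac{3+\alpha}{\alpha}\right)}\|\nabla u\|_{L^p(\mathcal C_{\sigma_h}\cap F)}.$$ -/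

import Mathlib

open Set Filter Topology MeasureTheory

noncomputable section

/-- Euclidean three-space. -/
abbrev E3 : Type := EuclideanSpace ℝ (Fin 3)

/-- A domain: a nonempty connected open set. -/
def IsDomain3 (D : Set E3) : Prop := IsOpen D ∧ IsConnected D

/-- `D` is a uniformly `C^{1,α}` domain with constants `k`, `σ₀`: at every boundary point there is
an isometry `R` of space that puts the point at the origin and for which the boundary avoids the
region `k|y'|^{1+α} < |y₃| < kσ₀^{1+α}`, `|y'| < σ₀`, with `D` lying on exactly one side: the upper
half of the region is in `D`, the lower half is in the complement of `D`. -/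
def UniformlyC1α (α k σ₀ : ℝ) (D : Set E3) : Prop :=
  IsDomain3 D ∧ ∀ x₀ ∈ frontier D, ∃ R : E3 ≃ᵢ E3, R 0 = x₀ ∧
    ∀ y : E3, √(y 0 ^ 2 + y 1 ^ 2) < σ₀ →
      k * √(y 0 ^ 2 + y 1 ^ 2) ^ (1 + α) < |y 2| → |y 2| < k * σ₀ ^ (1 + α) →
        R y ∉ frontier D ∧ (0 < y 2 → R y ∈ D) ∧ (y 2 < 0 → R y ∉ D)

/-- A smooth function with compact support in `Ω`. -/
def IsTestFunction {V : Type*} [NormedAddCommGroup V] [NormedSpace ℝ V]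
    (Ω : Set E3) (φ : E3 → V) : Prop :=
  ContDiff ℝ (⊤ : ℕ∞) φ ∧ HasCompactSupport φ ∧ tsupport φ ⊆ Ω

/-- `G` is the weak gradient of the vector field `u` in `Ω`; `G x v` is the derivative of `u`
at `x` in the direction `v`. -/
def HasWeakGradient (Ω : Set E3) (u : E3 → E3) (G : E3 → E3 →L[ℝ] E3) : Prop :=
  ∀ φ : E3 → ℝ, IsTestFunction Ω φ → ∀ v : E3,
    ∫ x in Ω, (fderiv ℝ φ x v) • u x = - ∫ x in Ω, φ x • G x v

/-- `u ∈ W^{1,p}(Ω)`, with weak gradient `G`. -/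
def MemW1p (p : ℝ) (Ω : Set E3) (u : E3 → E3) (G : E3 → E3 →L[ℝ] E3) : Prop :=
  MemLp u (ENNReal.ofReal p) (volume.restrict Ω) ∧
  MemLp G (ENNReal.ofReal p) (volume.restrict Ω) ∧
  HasWeakGradient Ω u G

/-- `u ∈ W^{1,p}_0(Ω)`, with weak gradient `G`: `u` is in the closure of the test fields in
`W^{1,p}(Ω)`. -/
def MemW1pZero (p : ℝ) (Ω : Set E3) (u : E3 → E3) (G : E3 → E3 →L[ℝ] E3) : Prop :=
  MemW1p p Ω u G ∧
  ∃ φ : ℕ → E3 → E3, (∀ n, IsTestFunction Ω (φ n)) ∧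
    Tendsto (fun n => eLpNorm (fun x => u x - φ n x) (ENNReal.ofReal p) (volume.restrict Ω))
      atTop (𝓝 0) ∧
    Tendsto (fun n => eLpNorm (fun x => G x - fderiv ℝ (φ n) x) (ENNReal.ofReal p)
      (volume.restrict Ω)) atTop (𝓝 0)

/-- The cross product on Euclidean three-space. -/
def cross3 (a b : E3) : E3 := WithLp.toLp 2 (crossProduct a.ofLp b.ofLp)

/-- The rigid velocity field `u_* + ω × (x - x_*)`. -/
def rigidField (uStar ω xStar x : E3) : E3 := uStar + cross3 ω (x - xStar)

/-- `u ∈ W^{1,p}_0(S, Ω)`, with weak gradient `G`, where the rigid motion on `S` is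
`u_* + ω × (x - x_*)`. -/
def MemW1pZeroRigid (p : ℝ) (S Ω : Set E3) (u : E3 → E3) (G : E3 → E3 →L[ℝ] E3)
    (uStar ω xStar : E3) : Prop :=
  MemW1pZero p Ω u G ∧ xStar ∈ closure S ∧
    ∀ᵐ x ∂(volume.restrict S), u x = rigidField uStar ω xStar x

/-- The divergence of `u` vanishes in `Ω`, where `G` is the gradient of `u`. -/
def DivFree (Ω : Set E3) (G : E3 → E3 →L[ℝ] E3) : Prop :=
  ∀ᵐ x ∂(volume.restrict Ω), ∑ i : Fin 3, (G x (EuclideanSpace.single i 1)) i = 0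

/-- The distance `inf {|x - y| : x ∈ S, y ∈ ∂Ω}` of the body from the boundary. -/
def bodyDist (S Ω : Set E3) : ℝ := sInf (Set.image2 dist S (frontier Ω))

/-- The unit vector of the `x₃`-axis, from `Q` to `P`. -/
def axis (P Q : E3) : E3 := (dist P Q)⁻¹ • (P - Q)

/-- The component of a vector along the `x₃`-axis. -/
def normalPart (P Q v : E3) : ℝ := inner ℝ v (axis P Q)

/-- The part of a vector in the plane orthogonal to the `x₃`-axis. -/
def tangentPart (P Q v : E3) : E3 := v - normalPart P Q v • axis P Q

/-- The cylinder `|x'| < σ`, `-kσ^{1+α} < x₃ < h + 2kσ^{1+α}` in coordinates with origin `Q` and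
`x₃`-axis directed from `Q` to `P`, where `h = |PQ|`. -/
def gapCylinder (α k σ : ℝ) (P Q : E3) : Set E3 :=
  {x | ‖tangentPart P Q (x - Q)‖ < σ ∧
    -(k * σ ^ (1 + α)) < normalPart P Q (x - Q) ∧
    normalPart P Q (x - Q) < dist P Q + 2 * k * σ ^ (1 + α)}

/-- The fluid region. -/
def fluid (S Ω : Set E3) : Set E3 := Ω \ closure S

/-- The norm of `G` in `L^p(A)`, with the operator norm on matrices. -/
def LpNormOn (p : ℝ) (A : Set E3) (G : E3 → E3 →L[ℝ] E3) : ℝ :=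
  (eLpNorm G (ENNReal.ofReal p) (volume.restrict A)).toReal

end

/-! At the scale `σ = h^{1/(1+α)}` the gap is a slab of height comparable to `h` and width `σ`: over
a square of side `σ` around the axis, the layer from `-2kh` to `-kh` misses `Ω`, and the layer from
`h + kh` to `h + 2kh` lies in `S`. A cutoff `χ` of the height alone rises in the lower layer, where
`u` is not seen, and falls in the upper one, where `u` is the rigid motion. With `κ = -χ'` on the
upper layer and a tangential weight `f g`, integration by parts along the axis turns the `f g κ`
moment of the rigid motion into the integral of `f g χ ∂₃u` over `Ω` (`GapFlow.integral_layer`). All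
four quantities are such moments: an even profile gives the velocity, its first-moment profile gives
`ω × b₀` and `ω × b₁`.

For the normal component, `div u = 0` replaces `∂₃u₃` by tangential derivatives. These move onto `f
g` and cost `1/σ`; a second integration by parts in height, with primitive `tχ`, gains `h`
(`GapFlow.inner_integral_layer`). The resulting factor `h/σ` is the difference between the rates of
`u_{P3}`, `ω_τ` and those of `u_{Pτ}`, `ω_3`; `ω_τ` belongs to the first group because it is read
off the normal components of `ω × b₀`, `ω × b₁`.

The integrals run over `Ω`, so they also contain the part in `S`, where `∂₃u = ω × b₂`. This is
orthogonal to `b₂`, hence absent from the direct estimate of normal components. That estimate bounds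
`ω × b₂` by the fluid part alone, and this suffices to absorb the body part everywhere else
(`GapFlow.exists_algebraic_bounds`). The rates are thus `h/σ³`, `1/σ²`, `h/σ⁴`, `1/σ³` times the
`L¹` norm of the gradient in the fluid gap; Hölder on a set of volume at most a multiple of `σ²h`
gives the stated powers. -/

/-! ### Normals of uniformly `C^{1,α}` domains. -/

/-- The unit vector `m` is the inner normal of `D` at `x₀` in the sense of `UniformlyC1α`. -/
def IsC1αNormal (α k σ₀ : ℝ) (D : Set E3) (x₀ m : E3) : Prop :=
  ‖m‖ = 1 ∧ ∀ x : E3, ‖x - x₀ - inner ℝ (x - x₀) m • m‖ < σ₀ →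
    k * ‖x - x₀ - inner ℝ (x - x₀) m • m‖ ^ (1 + α) < |inner ℝ (x - x₀) m| →
    |inner ℝ (x - x₀) m| < k * σ₀ ^ (1 + α) →
    x ∉ frontier D ∧ (0 < inner ℝ (x - x₀) m → x ∈ D) ∧ (inner ℝ (x - x₀) m < 0 → x ∉ D)

theorem UniformlyC1α.exists_normal {α k σ₀ : ℝ} {D : Set E3} (hD : UniformlyC1α α k σ₀ D)
    {x₀ : E3} (hx₀ : x₀ ∈ frontier D) : ∃ m, IsC1αNormal α k σ₀ D x₀ m := by
  obtain ⟨R, hR0, hR⟩ := hD.2 x₀ hx₀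
  -- By Mazur–Ulam the isometry is affine; its linear part carries the third coordinate vector to
  -- the normal.
  set T : E3 ≃ᵢ E3 := R.trans (IsometryEquiv.subRight x₀) with hT
  have hT0 : T 0 = 0 := by simp [hT, hR0]
  set A := T.toRealLinearIsometryEquivOfMapZero hT0 with hA
  have hAT : ∀ y, A y = R y - x₀ := fun y => by
    rw [hA, IsometryEquiv.coe_toRealLinearIsometryEquivOfMapZero]; simp [hT]
  refine ⟨A (EuclideanSpace.single 2 1), by simp, fun x h1 h2 h3 => ?_⟩
  obtain ⟨y, hy⟩ : ∃ y, A y = x - x₀ := ⟨A.symm (x - x₀), by simp⟩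
  have hRy : R y = x := by have := hAT y; rw [hy] at this; exact (sub_left_injective this).symm
  have hin : inner ℝ (x - x₀) (A (EuclideanSpace.single 2 1)) = y 2 := by
    rw [← hy, A.inner_map_map]; simp [EuclideanSpace.inner_single_right]
  have hnorm : ‖x - x₀ - y 2 • A (EuclideanSpace.single 2 1)‖ = √(y 0 ^ 2 + y 1 ^ 2) := by
    rw [← hy, ← map_smul, ← map_sub, A.norm_map, EuclideanSpace.norm_eq, Fin.sum_univ_three]
    simp
  rw [hin] at h1 h2 h3 ⊢
  rw [hnorm] at h1 h2
  have := hR y h1 h2 h3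
  rwa [hRy] at this

theorem eventually_mul_rpow_lt {α a c : ℝ} (hα : 0 < α) (hc : 0 < c) :
    ∀ᶠ r : ℝ in 𝓝[>] 0, a * r ^ (1 + α) < c * r := by
  have h1 : Tendsto (fun r : ℝ => a * r ^ α) (𝓝[>] 0) (𝓝 (a * 0 ^ α)) :=
    ((Real.continuous_rpow_const hα.le).tendsto 0 |>.const_mul a).mono_left nhdsWithin_le_nhds
  rw [Real.zero_rpow hα.ne', mul_zero] at h1
  filter_upwards [h1.eventually_lt_const hc, self_mem_nhdsWithin] with r hr hr0
  have hr0 : 0 < r := hr0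
  rw [add_comm, Real.rpow_add hr0, Real.rpow_one, ← mul_assoc]
  exact mul_lt_mul_of_pos_right hr hr0

theorem eventually_mul_lt {a c : ℝ} (hc : 0 < c) : ∀ᶠ r : ℝ in 𝓝[>] 0, a * r < c := by
  have h1 : Tendsto (fun r : ℝ => a * r) (𝓝[>] 0) (𝓝 (a * 0)) :=
    ((continuous_const_mul a).tendsto 0).mono_left nhdsWithin_le_nhds
  rw [mul_zero] at h1
  exact h1.eventually_lt_const hc

namespace IsC1αNormal

variable {α k σ₀ : ℝ} {D : Set E3} {x₀ m n : E3}

/-- Along a transversal ray the height grows like `ε`, the excluded cusp only like `ε^{1+α}`, so the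
ray soon runs in the controlled region. -/
theorem eventually_ray (hN : IsC1αNormal α k σ₀ D x₀ m) (hα : 0 < α) (hk : 0 < k)
    (hσ₀ : 0 < σ₀) {v : E3} (hv : inner ℝ v m ≠ 0) :
    ∀ᶠ ε : ℝ in 𝓝[>] 0, (0 < inner ℝ v m → x₀ + ε • v ∈ D) ∧
      (inner ℝ v m < 0 → x₀ + ε • v ∉ D) := by
  set t := ‖v - inner ℝ v m • m‖ with ht
  have hv' : 0 < |inner ℝ v m| := abs_pos.2 hv
  filter_upwards [eventually_mul_rpow_lt (a := k * t ^ (1 + α)) hα hv',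
    eventually_mul_lt (a := t) hσ₀,
    eventually_mul_lt (a := |inner ℝ v m|) (mul_pos hk (Real.rpow_pos_of_pos hσ₀ (1 + α))),
    self_mem_nhdsWithin] with ε h1 h2 h3 hε
  have hε : 0 < ε := hε
  have e1 : inner ℝ (x₀ + ε • v - x₀) m = ε * inner ℝ v m := by
    rw [add_sub_cancel_left, real_inner_smul_left]
  have e2 : ‖x₀ + ε • v - x₀ - (ε * inner ℝ v m) • m‖ = ε * t := by
    rw [add_sub_cancel_left, mul_smul, ← smul_sub, norm_smul, Real.norm_of_nonneg hε.le]
  have := hN.2 (x₀ + ε • v)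
  rw [e1, e2, abs_mul, abs_of_pos hε, Real.mul_rpow hε.le (norm_nonneg _)] at this
  obtain ⟨-, h4, h5⟩ := this (by linarith) (by linarith) (by linarith)
  exact ⟨fun h => h4 (mul_pos hε h), fun h => h5 (mul_neg_of_pos_of_neg hε h)⟩

/-- If the normals differed, the direction `n - m` would point out of `D` across the surface yet
into the ball: the squared distance to the centre changes by `2ε(1 - ⟨n, m⟩)(ε - h) < 0`. -/
theorem eq_of_ball_subset (hN : IsC1αNormal α k σ₀ D x₀ m) (hα : 0 < α) (hk : 0 < k)
    (hσ₀ : 0 < σ₀) (hn : ‖n‖ = 1) {h : ℝ} (hh : 0 < h)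
    (hB : Metric.ball (x₀ + h • n) h ⊆ D) : m = n := by
  by_contra hne
  have hlt : inner ℝ n m < 1 := inner_lt_one_iff_real_of_norm_eq_one hn hN.1 |>.2 (Ne.symm hne)
  have hv : inner ℝ (n - m) m < 0 := by
    rw [inner_sub_left, real_inner_self_eq_norm_sq, hN.1]; linarith
  obtain ⟨ε, h1, h2, hε⟩ := ((hN.eventually_ray hα hk hσ₀ hv.ne).and
    ((eventually_mul_lt (a := 1) hh).and self_mem_nhdsWithin)).exists
  have hε : 0 < ε := hε
  refine h1.2 hv (hB ?_)
  rw [mem_ball_iff_norm, ← sq_lt_sq₀ (norm_nonneg _) hh.le]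
  have : x₀ + ε • (n - m) - (x₀ + h • n) = ε • (n - m) - h • n := by abel
  rw [this, norm_sub_sq_real, norm_smul, norm_smul, real_inner_smul_left, real_inner_smul_right,
    mul_pow, mul_pow, norm_sub_sq_real, hn, hN.1, inner_sub_left, real_inner_self_eq_norm_sq, hn,
    real_inner_comm n m, Real.norm_of_nonneg hε.le, Real.norm_of_nonneg hh.le]
  nlinarith [mul_pos hε (sub_pos.2 hlt), mul_pos (mul_pos hε (sub_pos.2 hlt)) (sub_pos.2 h2)]

theorem eq_of_ball_disjoint (hN : IsC1αNormal α k σ₀ D x₀ m) (hα : 0 < α) (hk : 0 < k)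
    (hσ₀ : 0 < σ₀) (hn : ‖n‖ = 1) {h : ℝ} (hh : 0 < h)
    (hB : Disjoint (Metric.ball (x₀ - h • n) h) D) : m = n := by
  by_contra hne
  have hlt : inner ℝ m n < 1 := inner_lt_one_iff_real_of_norm_eq_one hN.1 hn |>.2 hne
  have hv : 0 < inner ℝ (m - n) m := by
    rw [inner_sub_left, real_inner_self_eq_norm_sq, hN.1, real_inner_comm]; linarith
  obtain ⟨ε, h1, h2, hε⟩ := ((hN.eventually_ray hα hk hσ₀ hv.ne').and
    ((eventually_mul_lt (a := 1) hh).and self_mem_nhdsWithin)).exists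
  have hε : 0 < ε := hε
  refine Set.disjoint_left.1 hB ?_ (h1.1 hv)
  rw [mem_ball_iff_norm, ← sq_lt_sq₀ (norm_nonneg _) hh.le]
  have : x₀ + ε • (m - n) - (x₀ - h • n) = ε • (m - n) + h • n := by abel
  rw [this, norm_add_sq_real, norm_smul, norm_smul, real_inner_smul_left, real_inner_smul_right,
    mul_pow, mul_pow, norm_sub_sq_real, hn, hN.1, inner_sub_left, real_inner_self_eq_norm_sq, hn,
    Real.norm_of_nonneg hε.le, Real.norm_of_nonneg hh.le]
  nlinarith [mul_pos hε (sub_pos.2 hlt), mul_pos (mul_pos hε (sub_pos.2 hlt)) (sub_pos.2 h2)]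

/-- Porosity of the boundary: every small ball centred on it contains a ball of proportional radius
that misses it. Heights there exceed `3r/8`, and tangential distances are at most `r/4`. -/
theorem eventually_ball_disjoint_frontier (hN : IsC1αNormal α k σ₀ D x₀ m) (hα : 0 < α)
    (hk : 0 < k) (hσ₀ : 0 < σ₀) :
    ∀ᶠ r : ℝ in 𝓝[>] 0, Disjoint (Metric.ball (x₀ + (r / 2) • m) (r / 8)) (frontier D) := by
  filter_upwards [eventually_mul_rpow_lt (a := k * (1 / 4) ^ (1 + α)) (c := 3 / 8) hα
    (by norm_num), eventually_mul_lt (a := 1 / 4) hσ₀,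
    eventually_mul_lt (a := 5 / 8) (mul_pos hk (Real.rpow_pos_of_pos hσ₀ (1 + α))),
    self_mem_nhdsWithin] with r h1 h2 h3 hr
  have hr : 0 < r := hr
  refine Set.disjoint_left.2 fun z hz => ?_
  rw [mem_ball_iff_norm] at hz
  set w := z - (x₀ + (r / 2) • m) with hw
  have hzx : z - x₀ = (r / 2) • m + w := by rw [hw]; abel
  have hwm : |inner ℝ w m| ≤ ‖w‖ := by simpa [hN.1] using abs_real_inner_le_norm w m
  have e1 : inner ℝ (z - x₀) m = r / 2 + inner ℝ w m := by
    rw [hzx, inner_add_left, real_inner_smul_left, real_inner_self_eq_norm_sq, hN.1]; ring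
  have e2 : z - x₀ - (r / 2 + inner ℝ w m) • m = w - inner ℝ w m • m := by
    rw [hzx, add_smul]; abel
  have e3 : ‖w - inner ℝ w m • m‖ ≤ 1 / 4 * r := by
    refine (norm_sub_le _ _).trans ?_
    rw [norm_smul, hN.1, Real.norm_eq_abs]; linarith
  have h4 := abs_le.1 hwm
  have h5 : |r / 2 + inner ℝ w m| = r / 2 + inner ℝ w m := abs_of_pos (by linarith)
  have key := hN.2 z
  rw [e1, e2, h5] at key
  refine (key (by linarith) ?_ (by linarith)).1
  calc k * ‖w - inner ℝ w m • m‖ ^ (1 + α) ≤ k * (1 / 4 * r) ^ (1 + α) := by gcongr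
    _ = k * (1 / 4) ^ (1 + α) * r ^ (1 + α) := by
      rw [Real.mul_rpow (by norm_num) hr.le, mul_assoc]
    _ < r / 2 + inner ℝ w m := by linarith

end IsC1αNormal

/-- A porous set has no density points, so Lebesgue's density theorem makes it null. This allows
integrals over `Ω` to be split into body and fluid. -/
theorem UniformlyC1α.volume_frontier {α k σ₀ : ℝ} {D : Set E3} (hD : UniformlyC1α α k σ₀ D)
    (hα : 0 < α) (hk : 0 < k) (hσ₀ : 0 < σ₀) : volume (frontier D) = 0 := by
  by_contra hne
  have hms : MeasurableSet (frontier D) := isClosed_frontier.measurableSet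
  have hae := Besicovitch.ae_tendsto_measure_inter_div (volume : Measure E3) (frontier D)
  rw [ae_restrict_iff' hms] at hae
  have : ∃ x ∈ frontier D, Tendsto (fun r => volume (frontier D ∩ Metric.closedBall x r) /
      volume (Metric.closedBall x r)) (𝓝[>] 0) (𝓝 1) := by
    by_contra hcon
    push Not at hcon
    refine hne (measure_mono_null (fun x hx => ?_) hae)
    exact fun h => hcon x hx (h hx)
  obtain ⟨x, hx, hlim⟩ := this
  obtain ⟨m, hm⟩ := hD.exists_normal hx
  set c : ENNReal := ENNReal.ofReal ((1 / 8) ^ 3) with hc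
  have hc0 : c ≠ 0 := by rw [hc]; norm_num
  have hev : ∀ᶠ r in 𝓝[>] (0 : ℝ), volume (frontier D ∩ Metric.closedBall x r) /
      volume (Metric.closedBall x r) ≤ 1 - c := by
    filter_upwards [hm.eventually_ball_disjoint_frontier hα hk hσ₀, self_mem_nhdsWithin]
      with r hr hr0
    have hr0 : 0 < r := hr0
    have hV0 : volume (Metric.closedBall x r) ≠ 0 := (Metric.measure_closedBall_pos _ _ hr0).ne'
    have hVt : volume (Metric.closedBall x r) ≠ ⊤ := measure_closedBall_lt_top.ne
    have hsub : Metric.ball (x + (r / 2) • m) (r / 8) ⊆ Metric.closedBall x r := by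
      intro z hz
      rw [mem_ball_iff_norm] at hz
      rw [mem_closedBall_iff_norm]
      calc ‖z - x‖ = ‖(z - (x + (r / 2) • m)) + (r / 2) • m‖ := by congr 1; abel
        _ ≤ r / 8 + r / 2 := by
          refine (norm_add_le _ _).trans (add_le_add hz.le ?_)
          rw [norm_smul, hm.1, Real.norm_of_nonneg (by linarith)]; linarith
        _ ≤ r := by linarith
    have hball : volume (Metric.ball (x + (r / 2) • m) (r / 8)) =
        c * volume (Metric.closedBall x r) := by
      have := Measure.addHaar_ball_mul (volume : Measure E3) (x + (r / 2) • m)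
        (by norm_num : (0:ℝ) ≤ 1 / 8) r
      rw [show r / 8 = 1 / 8 * r by ring, this, Measure.addHaar_closedBall _ _ hr0.le,
        Measure.addHaar_ball _ _ hr0.le, hc]
      simp
    have hle : volume (frontier D ∩ Metric.closedBall x r) ≤
        (1 - c) * volume (Metric.closedBall x r) := by
      rw [ENNReal.sub_mul (fun _ _ => hVt), one_mul, ← hball,
        ← measure_sdiff hsub measurableSet_ball.nullMeasurableSet
          (measure_ball_lt_top.ne)]
      exact measure_mono fun z hz => ⟨hz.2, fun h => Set.disjoint_left.1 hr h hz.1⟩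
    exact ENNReal.div_le_of_le_mul hle
  have h1 := le_of_tendsto hlim hev
  exact (ENNReal.sub_lt_self ENNReal.one_ne_top one_ne_zero hc0).not_ge h1

/-! ### Geometry of the gap. -/

theorem bodyDist_le_dist {S Ω : Set E3} {x y : E3} (hx : x ∈ closure S) (hy : y ∈ frontier Ω) :
    bodyDist S Ω ≤ dist x y := by
  have hbdd : BddBelow (Set.image2 dist S (frontier Ω)) :=
    ⟨0, by rintro _ ⟨a, -, b, -, rfl⟩; exact dist_nonneg⟩
  have hS : S ⊆ {x | bodyDist S Ω ≤ dist x y} := fun x hx =>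
    csInf_le hbdd ⟨x, hx, y, hy, rfl⟩
  exact (closure_minimal hS (isClosed_le continuous_const (by fun_prop))) hx

section Gap

variable {α k σ₀ h : ℝ} {Ω S : Set E3} {P Q : E3}

theorem norm_axis (hd : 0 < dist P Q) : ‖axis P Q‖ = 1 := by
  rw [axis, norm_smul, norm_inv, Real.norm_of_nonneg hd.le, ← dist_eq_norm, inv_mul_cancel₀ hd.ne']

theorem dist_smul_axis (hd : 0 < dist P Q) : dist P Q • axis P Q = P - Q := by
  rw [axis, smul_smul, mul_inv_cancel₀ hd.ne', one_smul]

/-- The definition supplies a normal at `Q` with no relation to the axis. Minimality of `|PQ|` puts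
a ball centred at `P` and touching `Q` inside `Ω`, which forces the two to agree. -/
theorem isC1αNormal_domain (hΩ : UniformlyC1α α k σ₀ Ω) (hα : 0 < α) (hk : 0 < k) (hσ₀ : 0 < σ₀)
    (hSΩ : S ⊆ Ω) (hP : P ∈ frontier S) (hQ : Q ∈ frontier Ω) (hh : dist P Q = bodyDist S Ω)
    (hd : 0 < dist P Q) : IsC1αNormal α k σ₀ Ω Q (axis P Q) := by
  obtain ⟨m, hm⟩ := hΩ.exists_normal hQ
  have hPS : P ∈ closure S := frontier_subset_closure hP
  have hball : Disjoint (Metric.ball P (dist P Q)) (frontier Ω) := by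
    refine Set.disjoint_left.2 fun z hz hzf => ?_
    rw [Metric.mem_ball, dist_comm, hh] at hz
    exact absurd (bodyDist_le_dist hPS hzf) hz.not_ge
  have hsub : Metric.ball P (dist P Q) ⊆ Ω := by
    obtain ⟨y, hyS, hyP⟩ := Metric.mem_closure_iff.1 hPS _ hd
    have hpre : IsPreconnected (Metric.ball P (dist P Q)) := (convex_ball _ _).isPreconnected
    -- The ball avoids the boundary of `Ω` and is connected, so one point of `S` in it, present
    -- because `P` is in the closure of `S`, puts all of it in `Ω`.
    refine hpre.subset_left_of_subset_union hΩ.1.1 isClosed_closure.isOpen_compl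
      (disjoint_compl_right_iff_subset.2 subset_closure) (fun z hz => ?_)
      ⟨y, by rwa [Metric.mem_ball, dist_comm], hSΩ hyS⟩
    by_cases hzc : z ∈ closure Ω
    · rcases (closure_eq_self_union_frontier Ω ▸ hzc : z ∈ Ω ∪ frontier Ω) with h | h
      · exact Or.inl h
      · exact absurd h (Set.disjoint_left.1 hball hz)
    · exact Or.inr hzc
  have := hm.eq_of_ball_subset hα hk hσ₀ (norm_axis hd) hd
    (by rwa [dist_smul_axis hd, add_sub_cancel])
  rwa [← this]

theorem isC1αNormal_body (hS : UniformlyC1α α k σ₀ S) (hα : 0 < α) (hk : 0 < k) (hσ₀ : 0 < σ₀)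
    (hP : P ∈ frontier S) (hQ : Q ∈ frontier Ω) (hh : dist P Q = bodyDist S Ω)
    (hd : 0 < dist P Q) : IsC1αNormal α k σ₀ S P (axis P Q) := by
  obtain ⟨m, hm⟩ := hS.exists_normal hP
  have := hm.eq_of_ball_disjoint hα hk hσ₀ (norm_axis hd) hd (by
    rw [dist_smul_axis hd, sub_sub_cancel]
    refine Set.disjoint_left.2 fun z hz hzS => ?_
    rw [Metric.mem_ball, hh] at hz
    exact absurd (bodyDist_le_dist (subset_closure hzS) hQ) hz.not_ge)
  rwa [← this]

theorem notMem_of_normalPart_le (hN : IsC1αNormal α k σ₀ Ω Q (axis P Q)) (hα : 0 < α) (hk : 0 < k)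
    {σ : ℝ} (hσ : σ < σ₀) {x : E3} (hx : ‖tangentPart P Q (x - Q)‖ < σ)
    (h1 : -(k * σ₀ ^ (1 + α)) < normalPart P Q (x - Q))
    (h2 : normalPart P Q (x - Q) ≤ -(k * σ ^ (1 + α))) : x ∉ Ω := by
  have h0 : k * ‖tangentPart P Q (x - Q)‖ ^ (1 + α) < k * σ ^ (1 + α) := by gcongr
  have h3 : 0 ≤ k * ‖tangentPart P Q (x - Q)‖ ^ (1 + α) := by positivity
  have h4 : |normalPart P Q (x - Q)| = -normalPart P Q (x - Q) := abs_of_neg (by linarith)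
  exact (hN.2 x (hx.trans hσ) (show k * ‖tangentPart P Q (x - Q)‖ ^ (1 + α) < |normalPart P Q (x - Q)|
    by linarith) (show |normalPart P Q (x - Q)| < _ by linarith)).2.2
    (show normalPart P Q (x - Q) < 0 by linarith)

theorem mem_of_le_normalPart (hN : IsC1αNormal α k σ₀ S P (axis P Q)) (hd : 0 < dist P Q)
    (hα : 0 < α) (hk : 0 < k)
    {σ : ℝ} (hσ : σ < σ₀) {x : E3} (hx : ‖tangentPart P Q (x - Q)‖ < σ)
    (h1 : dist P Q + k * σ ^ (1 + α) ≤ normalPart P Q (x - Q))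
    (h2 : normalPart P Q (x - Q) < dist P Q + k * σ₀ ^ (1 + α)) : x ∈ S := by
  have e0 : x - P = x - Q - dist P Q • axis P Q := by rw [dist_smul_axis hd]; abel
  have e1 : inner ℝ (x - P) (axis P Q) = normalPart P Q (x - Q) - dist P Q := by
    rw [e0, inner_sub_left, real_inner_smul_left, real_inner_self_eq_norm_sq, norm_axis hd,
      normalPart]; ring
  have e2 : x - P - inner ℝ (x - P) (axis P Q) • axis P Q = tangentPart P Q (x - Q) := by
    rw [e1, e0, tangentPart, sub_smul]; abel
  have h0 : k * ‖tangentPart P Q (x - Q)‖ ^ (1 + α) < k * σ ^ (1 + α) := by gcongr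
  have h3 : 0 ≤ k * ‖tangentPart P Q (x - Q)‖ ^ (1 + α) := by positivity
  have key := hN.2 x
  rw [e2, e1, abs_of_pos (by linarith : 0 < normalPart P Q (x - Q) - dist P Q)] at key
  exact (key (hx.trans hσ) (by linarith) (by linarith)).2.1 (by linarith)

end Gap

/-! ### Weak gradients of zero-trace and rigid fields. -/

/-- The linear map `v ↦ ω × v`. -/
noncomputable def crossCLM (ω : E3) : E3 →L[ℝ] E3 :=
  LinearMap.toContinuousLinearMap
    { toFun := cross3 ω
      map_add' := fun a b => by simp [cross3]
      map_smul' := fun c a => by simp [cross3] }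

theorem crossCLM_apply (ω v : E3) : crossCLM ω v = cross3 ω v := rfl

theorem hasFDerivAt_rigidField (uStar ω xStar x : E3) :
    HasFDerivAt (rigidField uStar ω xStar) (crossCLM ω) x :=
  ((crossCLM ω).hasFDerivAt.comp x ((hasFDerivAt_id x).sub_const xStar)).const_add uStar

section Limits

variable {F : Type*} [NormedAddCommGroup F] [NormedSpace ℝ F] {μ : Measure E3}
  [IsFiniteMeasureOnCompacts μ] {p : ENNReal} {g : E3 → ℝ} {f : E3 → F}

theorem integrable_smul_of_memLp (hp : 1 ≤ p) (hg : Continuous g) (hgc : HasCompactSupport g)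
    (hf : MemLp f p μ) : Integrable (fun x => g x • f x) μ := by
  have : p.HolderConjugate p.conjExponent := ENNReal.HolderConjugate.conjExponent hp
  have : ENNReal.HolderTriple p.conjExponent p 1 := ENNReal.HolderTriple.symm
  have hgm : MemLp g p.conjExponent μ := hg.memLp_of_hasCompactSupport hgc
  exact memLp_one_iff_integrable.1 (hf.smul hgm)

/-- A continuous compactly supported weight lies in every `L^q`, so Hölder with the conjugate
exponent covers `p = 1` as well. -/
theorem tendsto_integral_smul_of_eLpNorm (hp : 1 ≤ p) (hg : Continuous g)
    (hgc : HasCompactSupport g) (hf : MemLp f p μ) {fn : ℕ → E3 → F} (hfn : ∀ n, MemLp (fn n) p μ)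
    (hlim : Tendsto (fun n => eLpNorm (fun x => f x - fn n x) p μ) atTop (𝓝 0)) :
    Tendsto (fun n => ∫ x, g x • fn n x ∂μ) atTop (𝓝 (∫ x, g x • f x ∂μ)) := by
  have : p.HolderConjugate p.conjExponent := ENNReal.HolderConjugate.conjExponent hp
  have : ENNReal.HolderTriple p.conjExponent p 1 := ENNReal.HolderTriple.symm
  have hgm : MemLp g p.conjExponent μ := hg.memLp_of_hasCompactSupport hgc
  refine tendsto_integral_of_L1' _ (integrable_smul_of_memLp hp hg hgc hf).1
    (Eventually.of_forall fun n => integrable_smul_of_memLp hp hg hgc (hfn n)) ?_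
  have hz : Tendsto (fun n => eLpNorm g p.conjExponent μ * eLpNorm (fun x => f x - fn n x) p μ)
      atTop (𝓝 0) := by
    simpa using ENNReal.Tendsto.const_mul hlim (Or.inr hgm.2.ne)
  refine tendsto_of_tendsto_of_tendsto_of_le_of_le tendsto_const_nhds hz (fun _ => zero_le)
    fun n => ?_
  have := eLpNorm_smul_le_mul_eLpNorm (p := p.conjExponent) (q := p) (r := 1)
    (hf.sub (hfn n)).1 hgm.1
  refine le_trans (le_of_eq ?_) this
  rw [← eLpNorm_neg]
  congr 1
  ext x
  simp [smul_sub]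

end Limits

section Weak

variable {p : ℝ} {Ω S : Set E3} {u : E3 → E3} {G : E3 → E3 →L[ℝ] E3}

theorem integral_fderiv_smul_eq_neg {η : E3 → ℝ} (hη : ContDiff ℝ (⊤ : ℕ∞) η)
    (hηc : HasCompactSupport η) {φ : E3 → E3} (hφ : ContDiff ℝ 1 φ) (v : E3) :
    ∫ x, fderiv ℝ η x v • φ x = -∫ x, η x • fderiv ℝ φ x v := by
  have hη1 : ContDiff ℝ 1 η := hη.of_le (by exact_mod_cast le_top)
  have hη' : Continuous fun x => fderiv ℝ η x v :=
    (hη1.continuous_fderiv one_ne_zero).clm_apply continuous_const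
  have hφ' : Continuous fun x => fderiv ℝ φ x v :=
    (hφ.continuous_fderiv one_ne_zero).clm_apply continuous_const
  rw [integral_smul_fderiv_eq_neg_fderiv_smul_of_integrable, neg_neg]
  · exact (hη'.smul hφ.continuous).integrable_of_hasCompactSupport
      ((hηc.fderiv_apply (𝕜 := ℝ) v).smul_right)
  · exact (hη.continuous.smul hφ').integrable_of_hasCompactSupport hηc.smul_right
  · exact (hη.continuous.smul hφ.continuous).integrable_of_hasCompactSupport hηc.smul_right
  · exact fun x _ => (hη1.differentiable one_ne_zero) x
  · exact fun x _ => (hφ.differentiable one_ne_zero) x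

/-- The zero boundary values in use: `η` may be supported across the boundary of `Ω`. The identity
holds for the approximating test fields, which vanish outside `Ω`, and passes to the limit. -/
theorem MemW1pZero.integral_fderiv_smul (hu : MemW1pZero p Ω u G) (hp : 1 ≤ p)
    {η : E3 → ℝ} (hη : ContDiff ℝ (⊤ : ℕ∞) η) (hηc : HasCompactSupport η) (v : E3) :
    ∫ x in Ω, fderiv ℝ η x v • u x = -∫ x in Ω, η x • G x v := by
  obtain ⟨⟨hu1, hG1, -⟩, φ, hφ, hlu, hlG⟩ := hu
  have hp' : 1 ≤ ENNReal.ofReal p := by simpa using hp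
  have hφ1 : ∀ n, ContDiff ℝ 1 (φ n) := fun n => (hφ n).1.of_le (by exact_mod_cast le_top)
  have hη1 : ContDiff ℝ 1 η := hη.of_le (by exact_mod_cast le_top)
  have hη' : Continuous fun x => fderiv ℝ η x v :=
    (hη1.continuous_fderiv one_ne_zero).clm_apply continuous_const
  have hφ'c : ∀ n, Continuous (fderiv ℝ (φ n)) := fun n => (hφ1 n).continuous_fderiv one_ne_zero
  have hlim1 := tendsto_integral_smul_of_eLpNorm (μ := volume.restrict Ω) hp' hη'
    (hηc.fderiv_apply (𝕜 := ℝ) v) hu1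
    (fun n => (hφ1 n).continuous.memLp_of_hasCompactSupport (hφ n).2.1) hlu
  have hmem : ∀ n, MemLp (fderiv ℝ (φ n)) (ENNReal.ofReal p) (volume.restrict Ω) := fun n =>
    (hφ'c n).memLp_of_hasCompactSupport ((hφ n).2.1.fderiv (𝕜 := ℝ))
  have hlim2 := tendsto_integral_smul_of_eLpNorm (μ := volume.restrict Ω) hp' hη.continuous
    hηc hG1 hmem hlG
  have happ : ∀ {K : E3 → E3 →L[ℝ] E3}, MemLp K (ENNReal.ofReal p) (volume.restrict Ω) →
      (∫ x in Ω, η x • K x) v = ∫ x in Ω, η x • K x v := fun hK => by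
    rw [ContinuousLinearMap.integral_apply
      (integrable_smul_of_memLp hp' hη.continuous hηc hK)]; rfl
  have hlim3 : Tendsto (fun n => -∫ x in Ω, η x • fderiv ℝ (φ n) x v) atTop
      (𝓝 (-∫ x in Ω, η x • G x v)) := by
    have := ((ContinuousLinearMap.apply ℝ E3 v).continuous.tendsto _).comp hlim2
    simp only [Function.comp_def, ContinuousLinearMap.apply_apply, happ hG1, happ (hmem _)] at this
    exact this.neg
  refine tendsto_nhds_unique hlim1 (hlim3.congr fun n => ?_)
  have h1 : ∀ x, x ∉ Ω → fderiv ℝ η x v • φ n x = 0 := fun x hx => by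
    rw [image_eq_zero_of_notMem_tsupport (fun h => hx ((hφ n).2.2 h)), smul_zero]
  have h2 : ∀ x, x ∉ Ω → η x • fderiv ℝ (φ n) x v = 0 := fun x hx => by
    have : fderiv ℝ (φ n) x = 0 := by
      by_contra h
      exact hx ((hφ n).2.2 (support_fderiv_subset ℝ h))
    rw [this]; simp
  rw [setIntegral_eq_integral_of_forall_compl_eq_zero h1,
    setIntegral_eq_integral_of_forall_compl_eq_zero h2, integral_fderiv_smul_eq_neg hη hηc (hφ1 n)]

/-- Weak gradients are local: against test functions supported in `S`, the field may be replaced by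
the rigid motion, whose classical derivative is `v ↦ ω × v`. -/
theorem gradient_eq_cross_of_rigid {uStar ω xStar : E3} (hu : MemW1p p Ω u G) (hp : 1 ≤ p)
    (hΩ : MeasurableSet Ω) (hSo : IsOpen S) (hSΩ : S ⊆ Ω)
    (hr : ∀ᵐ x ∂(volume.restrict S), u x = rigidField uStar ω xStar x) (v : E3) :
    ∀ᵐ x ∂(volume.restrict S), G x v = cross3 ω v := by
  obtain ⟨hu1, hG1, hw⟩ := hu
  have hp' : 1 ≤ ENNReal.ofReal p := by simpa using hp
  have hGv : MemLp (fun x => G x v) (ENNReal.ofReal p) (volume.restrict S) :=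
    ((ContinuousLinearMap.apply ℝ E3 v).comp_memLp' hG1).mono_measure
      (Measure.restrict_mono hSΩ le_rfl)
  have hloc : LocallyIntegrableOn (fun x => G x v - cross3 ω v) S volume := by
    refine (locallyIntegrableOn_of_locallyIntegrable_restrict
      (hGv.locallyIntegrable hp')).sub ?_
    exact (locallyIntegrable_const _).locallyIntegrableOn _
  rw [ae_restrict_iff' hSo.measurableSet]
  refine (hSo.ae_eq_zero_of_integral_contDiff_smul_eq_zero hloc fun g hg hgc hgS => ?_).mono
    fun x hx hxS => sub_eq_zero.1 (hx hxS)
  have hg0 : ∀ x, x ∉ S → g x = 0 := fun x hx =>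
    image_eq_zero_of_notMem_tsupport fun h => hx (hgS h)
  have hg0' : ∀ x, x ∉ S → fderiv ℝ g x v = 0 := fun x hx => by
    have : fderiv ℝ g x = 0 := by
      by_contra h
      exact hx (hgS (support_fderiv_subset ℝ h))
    rw [this]; simp
  have hwk := hw g ⟨hg, hgc, hgS.trans hSΩ⟩ v
  have e1 : ∫ x in Ω, fderiv ℝ g x v • u x = ∫ x, fderiv ℝ g x v • rigidField uStar ω xStar x := by
    rw [setIntegral_eq_of_subset_of_forall_sdiff_eq_zero hΩ hSΩ
      (fun x hx => by rw [hg0' x hx.2, zero_smul])]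
    refine (integral_congr_ae (hr.mono fun x hx => ?_)).trans
      (setIntegral_eq_integral_of_forall_compl_eq_zero (s := S)
        (fun x hx => by rw [hg0' x hx, zero_smul]))
    simp only [hx]
  have e2 : ∫ x in Ω, g x • G x v = ∫ x in S, g x • G x v :=
    setIntegral_eq_of_subset_of_forall_sdiff_eq_zero hΩ hSΩ
      (fun x hx => by rw [hg0 x hx.2, zero_smul])
  have hR : ContDiff ℝ 1 (rigidField uStar ω xStar) :=
    contDiff_const.add ((crossCLM ω).contDiff.comp (contDiff_id.sub contDiff_const))
  have e3 := integral_fderiv_smul_eq_neg hg hgc hR v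
  simp only [(hasFDerivAt_rigidField _ _ _ _).fderiv, crossCLM_apply] at e3
  have e4 : ∫ x in S, g x • cross3 ω v = ∫ x, g x • cross3 ω v :=
    setIntegral_eq_integral_of_forall_compl_eq_zero fun x hx => by rw [hg0 x hx, zero_smul]
  have i1 : Integrable (fun x => g x • G x v) (volume.restrict S) :=
    integrable_smul_of_memLp hp' hg.continuous hgc hGv
  have i2 : Integrable (fun x => g x • cross3 ω v) (volume.restrict S) :=
    ((hg.continuous.smul continuous_const).integrable_of_hasCompactSupport
      hgc.smul_right).integrableOn
  rw [← setIntegral_eq_integral_of_forall_compl_eq_zero (s := S)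
    (fun x hx => by rw [hg0 x hx, zero_smul])]
  simp only [smul_sub]
  rw [integral_sub i1 i2, e4, ← e2, sub_eq_zero]
  exact neg_injective (by rw [← hwk, e1, e3])

end Weak

/-! ### Product test functions in orthonormal coordinates. -/

/-- A smooth compactly supported function of one variable. -/
def IsTest (f : ℝ → ℝ) : Prop := ContDiff ℝ (⊤ : ℕ∞) f ∧ HasCompactSupport f

namespace IsTest

variable {f g : ℝ → ℝ}

theorem continuous (hf : IsTest f) : Continuous f := hf.1.continuous

theorem integrable (hf : IsTest f) : Integrable f := hf.continuous.integrable_of_hasCompactSupport hf.2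

theorem differentiable (hf : IsTest f) : Differentiable ℝ f :=
  hf.1.differentiable (by simp)

theorem deriv (hf : IsTest f) : IsTest (deriv f) :=
  ⟨(contDiff_infty_iff_deriv.1 hf.1).2, hf.2.deriv⟩

theorem mul_left (hf : IsTest f) (hg : ContDiff ℝ (⊤ : ℕ∞) g) : IsTest (fun t => g t * f t) :=
  ⟨hg.mul hf.1, hf.2.mul_left⟩

theorem id_mul (hf : IsTest f) : IsTest (fun t => t * f t) := hf.mul_left contDiff_id

theorem comp_div (hf : IsTest f) {σ : ℝ} (hσ : σ ≠ 0) : IsTest (fun t => f (t / σ)) :=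
  ⟨hf.1.comp (contDiff_id.div_const σ),
    hf.2.comp_homeomorph (Homeomorph.mulRight₀ σ⁻¹ (inv_ne_zero hσ))⟩

theorem exists_bound (hf : IsTest f) : ∃ C, 0 < C ∧ ∀ t, |f t| ≤ C := by
  obtain ⟨C, hC⟩ := hf.2.exists_bound_of_continuous hf.continuous
  exact ⟨max C 1, by positivity, fun t => (hC t).trans (le_max_left _ _)⟩

theorem integral_deriv (hf : IsTest f) : ∫ t, _root_.deriv f t = 0 :=
  integral_eq_zero_of_hasDerivAt_of_integrable (fun x => (hf.differentiable x).hasDerivAt)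
    hf.deriv.integrable hf.integrable

end IsTest

section Tensor

variable (b : OrthonormalBasis (Fin 3) ℝ E3) (Q : E3)

/-- The product `f(y₀) g(y₁) w(y₂)` in the coordinates `y` of the basis `b` with origin `Q`. -/
noncomputable def tens (f g w : ℝ → ℝ) (x : E3) : ℝ :=
  f (b.repr (x - Q) 0) * g (b.repr (x - Q) 1) * w (b.repr (x - Q) 2)

/-- The coordinates in the basis `b` with origin `Q`. -/
noncomputable def coordEquiv : E3 ≃ᵐ (Fin 3 → ℝ) :=
  (MeasurableEquiv.subRight Q).trans
    (b.measurableEquiv.trans (MeasurableEquiv.toLp 2 (Fin 3 → ℝ)).symm)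

theorem coordEquiv_apply (x : E3) (i : Fin 3) : coordEquiv b Q x i = b.repr (x - Q) i := rfl

theorem measurePreserving_coordEquiv : MeasurePreserving (coordEquiv b Q) volume volume :=
  (EuclideanSpace.volume_preserving_symm_measurableEquiv_toLp (Fin 3)).comp
    (b.measurePreserving_measurableEquiv.comp (measurePreserving_sub_right volume Q))

theorem tens_eq_prod (f g w : ℝ → ℝ) (x : E3) :
    tens b Q f g w x = ∏ i, (![f, g, w] i) (coordEquiv b Q x i) := by
  simp [Fin.prod_univ_three, coordEquiv_apply, tens]

theorem integral_tens (f g w : ℝ → ℝ) :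
    ∫ x, tens b Q f g w x = (∫ t, f t) * (∫ t, g t) * ∫ t, w t := by
  simp_rw [tens_eq_prod]
  rw [(measurePreserving_coordEquiv b Q).integral_comp' (fun y => ∏ i, (![f, g, w] i) (y i)),
    integral_fintype_prod_volume_eq_prod, Fin.prod_univ_three]
  simp

theorem volume_coord_box {r s t : ℝ} (hr : 0 < r) :
    volume {x | |b.repr (x - Q) 0| < r ∧ |b.repr (x - Q) 1| < r ∧
      s < b.repr (x - Q) 2 ∧ b.repr (x - Q) 2 < t} = ENNReal.ofReal (4 * r ^ 2 * (t - s)) := by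
  have : {x | |b.repr (x - Q) 0| < r ∧ |b.repr (x - Q) 1| < r ∧
      s < b.repr (x - Q) 2 ∧ b.repr (x - Q) 2 < t} =
      coordEquiv b Q ⁻¹' (Set.univ.pi fun i => Set.Ioo (![-r, -r, s] i) (![r, r, t] i)) := by
    ext x
    simp [Set.mem_pi, Fin.forall_fin_succ, coordEquiv_apply, abs_lt]
  rw [this, (measurePreserving_coordEquiv b Q).measure_preimage_equiv, Real.volume_pi_Ioo,
    Fin.prod_univ_three]
  simp only [Matrix.cons_val_zero, Matrix.cons_val_one, Matrix.cons_val_two, Matrix.tail_cons,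
    Matrix.head_cons]
  rw [← ENNReal.ofReal_mul (by linarith), ← ENNReal.ofReal_mul (by nlinarith)]
  congr 1; ring

theorem hasFDerivAt_coord (i : Fin 3) (x : E3) :
    HasFDerivAt (fun x => b.repr (x - Q) i) (innerSL ℝ (b i)) x := by
  simp_rw [b.repr_apply_apply]
  exact ((innerSL ℝ (b i)).hasFDerivAt).comp x ((hasFDerivAt_id x).sub_const Q)

theorem contDiff_coord (i : Fin 3) : ContDiff ℝ (⊤ : ℕ∞) (fun x => b.repr (x - Q) i) := by
  simp_rw [b.repr_apply_apply]
  exact (innerSL ℝ (b i)).contDiff.comp (contDiff_id.sub contDiff_const)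

variable {f g w : ℝ → ℝ}

theorem contDiff_tens (hf : IsTest f) (hg : IsTest g) (hw : IsTest w) :
    ContDiff ℝ (⊤ : ℕ∞) (tens b Q f g w) :=
  ((hf.1.comp (contDiff_coord b Q 0)).mul (hg.1.comp (contDiff_coord b Q 1))).mul
    (hw.1.comp (contDiff_coord b Q 2))

theorem hasCompactSupport_tens (hf : IsTest f) (hg : IsTest g) (hw : IsTest w) :
    HasCompactSupport (tens b Q f g w) := by
  obtain ⟨r, hr⟩ := hf.2.isCompact.isBounded.subset_closedBall 0
  obtain ⟨s, hs⟩ := hg.2.isCompact.isBounded.subset_closedBall 0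
  obtain ⟨t, ht⟩ := hw.2.isCompact.isBounded.subset_closedBall 0
  refine HasCompactSupport.intro (isCompact_closedBall Q (|r| + |s| + |t|)) fun x hx => ?_
  by_contra hne
  have h12 := mul_ne_zero_iff.1 hne
  have h1 := mul_ne_zero_iff.1 h12.1
  have e : ∀ {φ : ℝ → ℝ} {y ρ : ℝ}, φ y ≠ 0 → tsupport φ ⊆ Metric.closedBall 0 ρ → |y| ≤ |ρ| :=
    fun hy h => (by simpa using h (subset_tsupport _ hy) : |_| ≤ _).trans (le_abs_self _)
  have e0 := e h1.1 hr
  have e1 := e h1.2 hs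
  have e2 := e h12.2 ht
  refine hx (mem_closedBall_iff_norm.2 ?_)
  rw [← b.repr.norm_map, ← sq_le_sq₀ (norm_nonneg _) (by positivity), EuclideanSpace.norm_sq_eq,
    Fin.sum_univ_three]
  simp only [Real.norm_eq_abs]
  nlinarith [abs_nonneg (b.repr (x - Q) 0), abs_nonneg (b.repr (x - Q) 1),
    abs_nonneg (b.repr (x - Q) 2), mul_nonneg (abs_nonneg r) (abs_nonneg s),
    mul_nonneg (abs_nonneg r) (abs_nonneg t), mul_nonneg (abs_nonneg s) (abs_nonneg t)]

theorem integrable_tens (hf : IsTest f) (hg : IsTest g) (hw : IsTest w) :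
    Integrable (tens b Q f g w) :=
  (contDiff_tens b Q hf hg hw).continuous.integrable_of_hasCompactSupport
    (hasCompactSupport_tens b Q hf hg hw)

theorem fderiv_tens (hf : IsTest f) (hg : IsTest g) (hw : IsTest w) (x v : E3) :
    fderiv ℝ (tens b Q f g w) x v = inner ℝ (b 0) v * tens b Q (deriv f) g w x +
      inner ℝ (b 1) v * tens b Q f (deriv g) w x + inner ℝ (b 2) v * tens b Q f g (deriv w) x := by
  have h0 := (hf.differentiable (b.repr (x - Q) 0)).hasDerivAt.comp_hasFDerivAt x
    (hasFDerivAt_coord b Q 0 x)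
  have h1 := (hg.differentiable (b.repr (x - Q) 1)).hasDerivAt.comp_hasFDerivAt x
    (hasFDerivAt_coord b Q 1 x)
  have h2 := (hw.differentiable (b.repr (x - Q) 2)).hasDerivAt.comp_hasFDerivAt x
    (hasFDerivAt_coord b Q 2 x)
  have := ((h0.mul h1).mul h2).fderiv
  have e : fderiv ℝ (tens b Q f g w) x = _ := this
  rw [e]
  simp [tens, innerSL_apply_apply]
  ring

theorem fderiv_tens_basis (hf : IsTest f) (hg : IsTest g) (hw : IsTest w) (x : E3) :
    fderiv ℝ (tens b Q f g w) x (b 0) = tens b Q (deriv f) g w x ∧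
    fderiv ℝ (tens b Q f g w) x (b 1) = tens b Q f (deriv g) w x ∧
    fderiv ℝ (tens b Q f g w) x (b 2) = tens b Q f g (deriv w) x := by
  simp only [fderiv_tens b Q hf hg hw, b.inner_eq_ite]
  simp

/-- A rigid motion is affine in the coordinates, so Fubini expresses its weighted integral through
zeroth and first moments of the three factors. -/
theorem integral_tens_smul_affine (hf : IsTest f) (hg : IsTest g) (hw : IsTest w)
    {r : E3 → E3} {A B₀ B₁ B₂ : E3} (hr : ∀ x, r x = A + b.repr (x - Q) 0 • B₀ +
      b.repr (x - Q) 1 • B₁ + b.repr (x - Q) 2 • B₂) :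
    ∫ x, tens b Q f g w x • r x = ((∫ t, f t) * (∫ t, g t) * ∫ t, w t) • A +
      ((∫ t, t * f t) * (∫ t, g t) * ∫ t, w t) • B₀ +
      ((∫ t, f t) * (∫ t, t * g t) * ∫ t, w t) • B₁ +
      ((∫ t, f t) * (∫ t, g t) * ∫ t, t * w t) • B₂ := by
  have e : ∀ x, tens b Q f g w x • r x = tens b Q f g w x • A +
      tens b Q (fun t => t * f t) g w x • B₀ + tens b Q f (fun t => t * g t) w x • B₁ +
      tens b Q f g (fun t => t * w t) x • B₂ := fun x => by
    rw [hr]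
    simp only [tens]
    module
  simp_rw [e]
  have i0 := (integrable_tens b Q hf hg hw).smul_const A
  have i1 := (integrable_tens b Q hf.id_mul hg hw).smul_const B₀
  have i2 := (integrable_tens b Q hf hg.id_mul hw).smul_const B₁
  have i3 := (integrable_tens b Q hf hg hw.id_mul).smul_const B₂
  have i01 : Integrable fun x => tens b Q f g w x • A +
      tens b Q (fun t => t * f t) g w x • B₀ := i0.add i1
  have i012 : Integrable fun x => tens b Q f g w x • A +
      tens b Q (fun t => t * f t) g w x • B₀ + tens b Q f (fun t => t * g t) w x • B₁ := i01.add i2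
  rw [integral_add i012 i3, integral_add i01 i2, integral_add i0 i1]
  simp only [integral_smul_const, integral_tens]

end Tensor

/-! ### Cutoffs across the gap. -/

section Cutoff

/-- A smooth step: `0` for `t ≤ -2kh`, `1` for `-kh ≤ t`. -/
noncomputable def upCut (k h t : ℝ) : ℝ := Real.smoothTransition (2 + t / (k * h))

/-- A smooth step: `1` for `t ≤ h + kh`, `0` for `h + 2kh ≤ t`. -/
noncomputable def downCut (k h t : ℝ) : ℝ := Real.smoothTransition (2 - (t - h) / (k * h))

/-- A smooth cutoff: `1` on `[-kh, h + kh]`, `0` outside `(-2kh, h + 2kh)`. -/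
noncomputable def gapCut (k h t : ℝ) : ℝ := upCut k h t * downCut k h t

/-- The weight of the layer `[h + kh, h + 2kh]` in which `gapCut` decreases. -/
noncomputable def layerWeight (k h t : ℝ) : ℝ := -deriv (downCut k h) t

variable {k h : ℝ}

theorem contDiff_upCut : ContDiff ℝ (⊤ : ℕ∞) (upCut k h) :=
  Real.smoothTransition.contDiff.comp (contDiff_const.add (contDiff_id.div_const _))

theorem contDiff_downCut : ContDiff ℝ (⊤ : ℕ∞) (downCut k h) :=
  Real.smoothTransition.contDiff.comp
    (contDiff_const.sub ((contDiff_id.sub contDiff_const).div_const _))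

theorem differentiable_downCut : Differentiable ℝ (downCut k h) :=
  contDiff_downCut.differentiable (by simp)

theorem gapCut_nonneg (t : ℝ) : 0 ≤ gapCut k h t :=
  mul_nonneg (Real.smoothTransition.nonneg _) (Real.smoothTransition.nonneg _)

theorem gapCut_le_one (t : ℝ) : gapCut k h t ≤ 1 :=
  mul_le_one₀ (Real.smoothTransition.le_one _) (Real.smoothTransition.nonneg _)
    (Real.smoothTransition.le_one _)

theorem downCut_eq_one (hk : 0 < k) (hh : 0 < h) {t : ℝ} (ht : t ≤ h + k * h) :
    downCut k h t = 1 := by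
  have hkh := mul_pos hk hh
  refine Real.smoothTransition.one_of_one_le ?_
  have : (t - h) / (k * h) ≤ 1 := (div_le_one hkh).2 (by linarith)
  linarith

theorem downCut_eq_zero (hk : 0 < k) (hh : 0 < h) {t : ℝ} (ht : h + 2 * (k * h) ≤ t) :
    downCut k h t = 0 := by
  have hkh := mul_pos hk hh
  refine Real.smoothTransition.zero_of_nonpos ?_
  have : 2 ≤ (t - h) / (k * h) := (le_div_iff₀ hkh).2 (by linarith)
  linarith

theorem upCut_eq_one (hk : 0 < k) (hh : 0 < h) {t : ℝ} (ht : -(k * h) ≤ t) : upCut k h t = 1 := by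
  have hkh := mul_pos hk hh
  refine Real.smoothTransition.one_of_one_le ?_
  have : -1 ≤ t / (k * h) := (le_div_iff₀ hkh).2 (by linarith)
  linarith

theorem upCut_eq_zero (hk : 0 < k) (hh : 0 < h) {t : ℝ} (ht : t ≤ -(2 * (k * h))) :
    upCut k h t = 0 := by
  have hkh := mul_pos hk hh
  refine Real.smoothTransition.zero_of_nonpos ?_
  have : t / (k * h) ≤ -2 := (div_le_iff₀ hkh).2 (by linarith)
  linarith

theorem antitone_downCut (hk : 0 < k) (hh : 0 < h) : Antitone (downCut k h) := fun s t hst =>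
  Real.smoothTransition.monotone (by have := mul_pos hk hh; gcongr)

theorem gapCut_support (hk : 0 < k) (hh : 0 < h) {t : ℝ} (ht : gapCut k h t ≠ 0) :
    -(2 * (k * h)) < t ∧ t < h + 2 * (k * h) := by
  obtain ⟨h1, h2⟩ := mul_ne_zero_iff.1 ht
  exact ⟨lt_of_not_ge fun h => h1 (upCut_eq_zero hk hh h),
    lt_of_not_ge fun h => h2 (downCut_eq_zero hk hh h)⟩

theorem isTest_gapCut (hk : 0 < k) (hh : 0 < h) : IsTest (gapCut k h) := by
  refine ⟨contDiff_upCut.mul contDiff_downCut, HasCompactSupport.intro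
    (isCompact_Icc (a := -(2 * (k * h))) (b := h + 2 * (k * h))) fun t ht => ?_⟩
  by_contra hne
  obtain ⟨h1, h2⟩ := gapCut_support hk hh hne
  exact ht ⟨h1.le, h2.le⟩

theorem layerWeight_support (hk : 0 < k) (hh : 0 < h) {t : ℝ} (ht : layerWeight k h t ≠ 0) :
    h + k * h ≤ t ∧ t ≤ h + 2 * (k * h) := by
  constructor <;> by_contra! hlt <;> refine ht ?_
  · have : downCut k h =ᶠ[𝓝 t] fun _ => 1 := by
      filter_upwards [eventually_lt_nhds hlt] with s hs using downCut_eq_one hk hh hs.le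
    simp [layerWeight, this.deriv_eq]
  · have : downCut k h =ᶠ[𝓝 t] fun _ => 0 := by
      filter_upwards [eventually_gt_nhds hlt] with s hs using downCut_eq_zero hk hh hs.le
    simp [layerWeight, this.deriv_eq]

theorem deriv_gapCut (hk : 0 < k) (hh : 0 < h) {t : ℝ} (ht : -(k * h) < t) :
    deriv (gapCut k h) t = -layerWeight k h t := by
  have : gapCut k h =ᶠ[𝓝 t] downCut k h := by
    filter_upwards [eventually_gt_nhds ht] with s hs
    rw [gapCut, upCut_eq_one hk hh hs.le, one_mul]
  rw [this.deriv_eq, layerWeight, neg_neg]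

theorem deriv_gapCut_of_lt (hk : 0 < k) (hh : 0 < h) {t : ℝ} (ht : t < -(2 * (k * h))) :
    deriv (gapCut k h) t = 0 := by
  have : gapCut k h =ᶠ[𝓝 t] fun _ => 0 := by
    filter_upwards [eventually_lt_nhds ht] with s hs
    rw [gapCut, upCut_eq_zero hk hh hs.le, zero_mul]
  simp [this.deriv_eq]

theorem isTest_layerWeight (hk : 0 < k) (hh : 0 < h) : IsTest (layerWeight k h) := by
  refine ⟨(contDiff_infty_iff_deriv.1 contDiff_downCut).2.neg, HasCompactSupport.intro
    (isCompact_Icc (a := h + k * h) (b := h + 2 * (k * h))) fun t ht => ?_⟩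
  by_contra hne
  exact ht (layerWeight_support hk hh hne)

theorem layerWeight_nonneg (hk : 0 < k) (hh : 0 < h) (t : ℝ) : 0 ≤ layerWeight k h t :=
  neg_nonneg.2 (antitone_downCut hk hh).deriv_nonpos

theorem integral_layerWeight (hk : 0 < k) (hh : 0 < h) : ∫ t, layerWeight k h t = 1 := by
  have := integral_of_hasDerivAt_of_tendsto (f := fun t => -downCut k h t) (m := -1) (n := 0)
    (fun t => ((differentiable_downCut t).hasDerivAt).neg) (isTest_layerWeight hk hh).integrable
    (tendsto_const_nhds.congr' ?_) (tendsto_const_nhds.congr' ?_)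
  · rw [sub_neg_eq_add, zero_add] at this
    exact this
  · filter_upwards [eventually_le_atBot (h + k * h)] with t ht
    rw [downCut_eq_one hk hh ht]
  · filter_upwards [eventually_ge_atTop (h + 2 * (k * h))] with t ht
    rw [downCut_eq_zero hk hh ht, neg_zero]

/-- The weight is a probability density on a layer within `2kh` of height `h`. The bound later
transfers the mean velocity on the layer to the velocity at `P`. -/
theorem abs_integral_layerWeight_sub_le (hk : 0 < k) (hh : 0 < h) :
    |(∫ t, t * layerWeight k h t) - h| ≤ 2 * (k * h) := by
  have hT := isTest_layerWeight hk hh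
  have e : (∫ t, t * layerWeight k h t) - h = ∫ t, (t - h) * layerWeight k h t := by
    simp_rw [sub_mul]
    rw [integral_sub hT.id_mul.integrable (hT.integrable.const_mul h), integral_const_mul,
      integral_layerWeight hk hh, mul_one]
  have e2 : 2 * (k * h) = ∫ t, 2 * (k * h) * layerWeight k h t := by
    rw [integral_const_mul, integral_layerWeight hk hh, mul_one]
  rw [e, e2, ← Real.norm_eq_abs]
  refine norm_integral_le_of_norm_le (hT.integrable.const_mul _) (Eventually.of_forall fun t => ?_)
  have hkh := mul_pos hk hh
  rw [norm_mul, Real.norm_of_nonneg (layerWeight_nonneg hk hh t)]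
  by_cases ht : layerWeight k h t = 0
  · simp [ht]
  · obtain ⟨h1, h2⟩ := layerWeight_support hk hh ht
    refine mul_le_mul_of_nonneg_right ?_ (layerWeight_nonneg hk hh t)
    rw [Real.norm_eq_abs, abs_le]; constructor <;> linarith

end Cutoff

/-! ### Cross products in an orthonormal basis. -/

section Cross

theorem inner_cross3_self (ω v : E3) : inner ℝ (cross3 ω v) v = 0 := by
  simp [cross3, cross_apply, PiLp.inner_apply, Fin.sum_univ_three]; ring

theorem inner_cross3_comm (ω v w : E3) : inner ℝ (cross3 ω v) w = -inner ℝ (cross3 ω w) v := by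
  simp [cross3, cross_apply, PiLp.inner_apply, Fin.sum_univ_three]; ring

theorem norm_cross3_sq (ω v : E3) :
    ‖cross3 ω v‖ ^ 2 = ‖ω‖ ^ 2 * ‖v‖ ^ 2 - inner ℝ ω v ^ 2 := by
  simp [cross3, cross_apply, PiLp.inner_apply, Fin.sum_univ_three, EuclideanSpace.norm_sq_eq]; ring

variable (b : OrthonormalBasis (Fin 3) ℝ E3)

theorem norm_sq_eq_sum_inner (v : E3) :
    ‖v‖ ^ 2 = inner ℝ v (b 0) ^ 2 + inner ℝ v (b 1) ^ 2 + inner ℝ v (b 2) ^ 2 := by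
  rw [← b.repr.norm_map, EuclideanSpace.norm_sq_eq, Fin.sum_univ_three]
  simp [b.repr_apply_apply, real_inner_comm]

theorem norm_cross3_basis_sq (ω : E3) (i : Fin 3) :
    ‖cross3 ω (b i)‖ ^ 2 = ‖ω‖ ^ 2 - inner ℝ ω (b i) ^ 2 := by
  rw [norm_cross3_sq, b.orthonormal.1 i]; ring

/-- The basis may have either orientation, so only absolute values are available; the identity is
extracted from the norms of the three products `ω × bᵢ`. -/
theorem abs_inner_cross3_basis (ω : E3) :
    |inner ℝ (cross3 ω (b 0)) (b 1)| = |inner ℝ ω (b 2)| := by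
  have h0 := norm_cross3_basis_sq b ω 0
  have h1 := norm_cross3_basis_sq b ω 1
  have h2 := norm_cross3_basis_sq b ω 2
  rw [norm_sq_eq_sum_inner b (cross3 ω _), norm_sq_eq_sum_inner b ω, inner_cross3_self] at h0 h1 h2
  rw [inner_cross3_comm ω (b 1) (b 0)] at h1
  rw [inner_cross3_comm ω (b 2) (b 0), inner_cross3_comm ω (b 2) (b 1)] at h2
  rw [← sq_eq_sq_iff_abs_eq_abs]
  nlinarith

theorem rigidField_eq (uStar ω xStar x : E3) (Q : E3) :
    rigidField uStar ω xStar x = rigidField uStar ω xStar Q + b.repr (x - Q) 0 • cross3 ω (b 0) +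
      b.repr (x - Q) 1 • cross3 ω (b 1) + b.repr (x - Q) 2 • cross3 ω (b 2) := by
  have e : x - xStar = (Q - xStar) + (b.repr (x - Q) 0 • b 0 + b.repr (x - Q) 1 • b 1 +
      b.repr (x - Q) 2 • b 2) := by
    have := b.sum_repr (x - Q)
    rw [Fin.sum_univ_three] at this
    rw [this]; abel
  simp only [rigidField, ← crossCLM_apply, e, map_add, map_smul]
  abel

end Cross

/-! ### Integral identities for the flow in the gap. -/

/-- A solenoidal field `u` in `Ω` which is rigid in `S`, near a gap of width `h` between `S` and the
boundary of `Ω`, in the coordinates of the basis `b` with origin `Q`. The set `C` contains the part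
of the gap of radius `σ`. -/
structure GapFlow (p k σ h : ℝ) (Ω S C : Set E3) (b : OrthonormalBasis (Fin 3) ℝ E3) (Q : E3)
    (u : E3 → E3) (G : E3 → E3 →L[ℝ] E3) (uStar ω xStar : E3) : Prop where
  one_le_p : 1 ≤ p
  k_pos : 0 < k
  σ_pos : 0 < σ
  h_pos : 0 < h
  isOpen_domain : IsOpen Ω
  isOpen_body : IsOpen S
  subset : S ⊆ Ω
  frontier_null : volume (frontier S) = 0
  bottom : ∀ x, |b.repr (x - Q) 0| ≤ σ / 2 → |b.repr (x - Q) 1| ≤ σ / 2 →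
    -(2 * (k * h)) ≤ b.repr (x - Q) 2 → b.repr (x - Q) 2 ≤ -(k * h) → x ∉ Ω
  top : ∀ x, |b.repr (x - Q) 0| ≤ σ / 2 → |b.repr (x - Q) 1| ≤ σ / 2 →
    h + k * h ≤ b.repr (x - Q) 2 → b.repr (x - Q) 2 ≤ h + 2 * (k * h) → x ∈ S
  mem_cylinder : ∀ x ∈ Ω, |b.repr (x - Q) 0| ≤ σ / 2 → |b.repr (x - Q) 1| ≤ σ / 2 →
    -(2 * (k * h)) < b.repr (x - Q) 2 → b.repr (x - Q) 2 < h + 2 * (k * h) → x ∈ C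
  measurableSet_cylinder : MeasurableSet C
  volume_cylinder : volume C ≠ ⊤
  memW1pZero : MemW1pZero p Ω u G
  rigid : ∀ᵐ x ∂(volume.restrict S), u x = rigidField uStar ω xStar x
  divFree : DivFree Ω G

/-- A test function supported in `[-σ/2, σ/2]`. -/
def IsTestOn (σ : ℝ) (f : ℝ → ℝ) : Prop := IsTest f ∧ ∀ t, f t ≠ 0 → |t| ≤ σ / 2

theorem IsTestOn.deriv {σ : ℝ} {f : ℝ → ℝ} (hf : IsTestOn σ f) : IsTestOn σ (deriv f) := by
  refine ⟨hf.1.deriv, fun t ht => ?_⟩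
  by_contra! hlt
  refine ht ?_
  have : f =ᶠ[𝓝 t] fun _ => 0 := by
    filter_upwards [continuous_abs.continuousAt.eventually_const_lt hlt] with s hs
    by_contra h
    exact absurd (hf.2 s h) (not_le.2 hs)
  simp [this.deriv_eq]

namespace GapFlow

variable {p k σ h : ℝ} {Ω S C : Set E3} {b : OrthonormalBasis (Fin 3) ℝ E3} {Q : E3}
    {u : E3 → E3} {G : E3 → E3 →L[ℝ] E3} {uStar ω xStar : E3} {f g w : ℝ → ℝ}

/-- Over the square the cutoff rises only outside `Ω` and falls only inside `S`. Hence its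
derivative meets `u` only where `u` is the rigid motion. -/
theorem integral_deriv_gapCut (F : GapFlow p k σ h Ω S C b Q u G uStar ω xStar)
    (hf : IsTestOn σ f) (hg : IsTestOn σ g) (c : ℝ → ℝ) :
    ∫ x in Ω, tens b Q f g (fun t => c t * deriv (gapCut k h) t) x • u x =
      -∫ x, tens b Q f g (fun t => c t * layerWeight k h t) x • rigidField uStar ω xStar x := by
  have hoff : ∀ x, x ∉ S →
      tens b Q f g (fun t => c t * layerWeight k h t) x • rigidField uStar ω xStar x = 0 := by
    intro x hx
    by_contra hne
    obtain ⟨h12, h3⟩ := mul_ne_zero_iff.1 (smul_ne_zero_iff.1 hne).1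
    obtain ⟨h1, h2⟩ := mul_ne_zero_iff.1 h12
    obtain ⟨h4, h5⟩ := layerWeight_support F.k_pos F.h_pos (mul_ne_zero_iff.1 h3).2
    exact hx (F.top x (hf.2 _ h1) (hg.2 _ h2) h4 h5)
  rw [← setIntegral_eq_integral_of_forall_compl_eq_zero (s := Ω)
    (fun x hx => hoff x fun hS => hx (F.subset hS)), ← integral_neg]
  refine setIntegral_congr_ae F.isOpen_domain.measurableSet ?_
  filter_upwards [(ae_restrict_iff' F.isOpen_body.measurableSet).1 F.rigid] with x hx hxΩ
  by_cases hxS : x ∈ S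
  · rw [hx hxS, ← neg_smul]
    by_cases hfg : f (b.repr (x - Q) 0) * g (b.repr (x - Q) 1) = 0
    · simp only [tens, hfg, zero_mul, zero_smul, neg_zero]
    obtain ⟨h1, h2⟩ := mul_ne_zero_iff.1 hfg
    rcases lt_or_ge (-(k * h)) (b.repr (x - Q) 2) with h3 | h3
    · simp only [tens, deriv_gapCut F.k_pos F.h_pos h3, mul_neg, neg_smul]
    · rcases lt_or_ge (b.repr (x - Q) 2) (-(2 * (k * h))) with h4 | h4
      · have := deriv_gapCut_of_lt F.k_pos F.h_pos h4
        have h5 : layerWeight k h (b.repr (x - Q) 2) = 0 := by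
          by_contra h5
          have := layerWeight_support F.k_pos F.h_pos h5
          have := mul_pos F.k_pos F.h_pos
          linarith [F.h_pos]
        simp only [tens, this, h5, mul_zero, zero_smul, neg_zero]
      · exact absurd hxΩ (F.bottom x (hf.2 _ h1) (hg.2 _ h2) h4 h3)
  · rw [hoff x hxS, neg_zero]
    by_contra hne
    obtain ⟨h12, h3⟩ := mul_ne_zero_iff.1 (smul_ne_zero_iff.1 hne).1
    obtain ⟨h1, h2⟩ := mul_ne_zero_iff.1 h12
    have h3 := (mul_ne_zero_iff.1 h3).2
    rcases lt_or_ge (-(k * h)) (b.repr (x - Q) 2) with h4 | h4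
    · rw [deriv_gapCut F.k_pos F.h_pos h4, neg_ne_zero] at h3
      obtain ⟨h5, h6⟩ := layerWeight_support F.k_pos F.h_pos h3
      exact hxS (F.top x (hf.2 _ h1) (hg.2 _ h2) h5 h6)
    · rcases lt_or_ge (b.repr (x - Q) 2) (-(2 * (k * h))) with h5 | h5
      · exact h3 (deriv_gapCut_of_lt F.k_pos F.h_pos h5)
      · exact F.bottom x (hf.2 _ h1) (hg.2 _ h2) h5 h4 hxΩ

/-- Integration by parts along the gap. -/
theorem integral_layer (F : GapFlow p k σ h Ω S C b Q u G uStar ω xStar)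
    (hf : IsTestOn σ f) (hg : IsTestOn σ g) :
    ∫ x, tens b Q f g (layerWeight k h) x • rigidField uStar ω xStar x =
      ∫ x in Ω, tens b Q f g (gapCut k h) x • G x (b 2) := by
  have hχ := isTest_gapCut F.k_pos F.h_pos
  have h1 := F.memW1pZero.integral_fderiv_smul F.one_le_p (contDiff_tens b Q hf.1 hg.1 hχ)
    (hasCompactSupport_tens b Q hf.1 hg.1 hχ) (b 2)
  simp only [(fderiv_tens_basis b Q hf.1 hg.1 hχ _).2.2] at h1
  have h2 := F.integral_deriv_gapCut hf hg (fun _ => 1)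
  simp only [one_mul] at h2
  exact neg_injective (h2.symm.trans h1)

theorem integrable_smul_gradient (F : GapFlow p k σ h Ω S C b Q u G uStar ω xStar)
    (hf : IsTest f) (hg : IsTest g) (hw : IsTest w) (v : E3) :
    Integrable (fun x => tens b Q f g w x • G x v) (volume.restrict Ω) :=
  integrable_smul_of_memLp (by simpa using F.one_le_p) (contDiff_tens b Q hf hg hw).continuous
    (hasCompactSupport_tens b Q hf hg hw)
    ((ContinuousLinearMap.apply ℝ E3 v).comp_memLp' F.memW1pZero.1.2.1)

theorem integrable_smul_field (F : GapFlow p k σ h Ω S C b Q u G uStar ω xStar)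
    (hf : IsTest f) (hg : IsTest g) (hw : IsTest w) :
    Integrable (fun x => tens b Q f g w x • u x) (volume.restrict Ω) :=
  integrable_smul_of_memLp (by simpa using F.one_le_p) (contDiff_tens b Q hf hg hw).continuous
    (hasCompactSupport_tens b Q hf hg hw) F.memW1pZero.1.1

/-- Integration by parts against `tχ`, whose derivative is `χ + tχ'`. The point is that `tχ` is of
size `h`, so the remaining gradient term carries a factor `h`. -/
theorem integral_tens_gapCut (F : GapFlow p k σ h Ω S C b Q u G uStar ω xStar)
    (hf : IsTestOn σ f) (hg : IsTestOn σ g) :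
    ∫ x in Ω, tens b Q f g (gapCut k h) x • u x =
      (∫ x, tens b Q f g (fun t => t * layerWeight k h t) x • rigidField uStar ω xStar x) -
      ∫ x in Ω, tens b Q f g (fun t => t * gapCut k h t) x • G x (b 2) := by
  have hχ := isTest_gapCut F.k_pos F.h_pos
  have h1 := F.memW1pZero.integral_fderiv_smul F.one_le_p (contDiff_tens b Q hf.1 hg.1 hχ.id_mul)
    (hasCompactSupport_tens b Q hf.1 hg.1 hχ.id_mul) (b 2)
  simp only [(fderiv_tens_basis b Q hf.1 hg.1 hχ.id_mul _).2.2] at h1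
  have h2 := F.integral_deriv_gapCut hf hg (fun t => t)
  have hd : deriv (fun t => t * gapCut k h t) =
      fun t => gapCut k h t + t * deriv (gapCut k h) t := by
    ext t
    have := ((hasDerivAt_id' t).mul (hχ.differentiable t).hasDerivAt).deriv
    rwa [one_mul] at this
  have e : ∀ x, tens b Q f g (deriv (fun t => t * gapCut k h t)) x • u x =
      tens b Q f g (gapCut k h) x • u x +
        tens b Q f g (fun t => t * deriv (gapCut k h) t) x • u x := fun x => by
    simp only [hd, tens]; module
  simp_rw [e] at h1
  rw [integral_add (F.integrable_smul_field hf.1 hg.1 hχ)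
    (F.integrable_smul_field hf.1 hg.1 hχ.deriv.id_mul), h2] at h1
  rw [eq_sub_of_add_eq h1]
  abel

/-- The trace does not depend on the orthonormal basis. -/
theorem ae_trace_eq_zero (F : GapFlow p k σ h Ω S C b Q u G uStar ω xStar) :
    ∀ᵐ x ∂(volume.restrict Ω),
      inner ℝ (G x (b 0)) (b 0) + inner ℝ (G x (b 1)) (b 1) + inner ℝ (G x (b 2)) (b 2) = 0 := by
  filter_upwards [F.divFree] with x hx
  have h1 := LinearMap.trace_eq_sum_inner (G x : E3 →ₗ[ℝ] E3) b
  have h2 := LinearMap.trace_eq_sum_inner (G x : E3 →ₗ[ℝ] E3) (EuclideanSpace.basisFun (Fin 3) ℝ)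
  rw [h1, Fin.sum_univ_three] at h2
  rw [real_inner_comm, real_inner_comm (b 1), real_inner_comm (b 2)]
  refine Eq.trans h2 ?_
  rw [← hx]
  simp [EuclideanSpace.inner_single_left]

/-- The divergence-free condition moves the derivative of the normal velocity to the tangential
variables. -/
theorem inner_integral_layer (F : GapFlow p k σ h Ω S C b Q u G uStar ω xStar)
    (hf : IsTestOn σ f) (hg : IsTestOn σ g) :
    inner ℝ (∫ x, tens b Q f g (layerWeight k h) x • rigidField uStar ω xStar x) (b 2) =
      -inner ℝ (∫ x in Ω, tens b Q (deriv f) g (fun t => t * gapCut k h t) x • G x (b 2)) (b 0) -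
      inner ℝ (∫ x in Ω, tens b Q f (deriv g) (fun t => t * gapCut k h t) x • G x (b 2)) (b 1) := by
  have hχ := isTest_gapCut F.k_pos F.h_pos
  have hκ := (isTest_layerWeight F.k_pos F.h_pos).id_mul
  have hin : ∀ v : E3, inner ℝ (∫ x in Ω, tens b Q f g (gapCut k h) x • G x v) v =
      ∫ x in Ω, tens b Q f g (gapCut k h) x * inner ℝ (G x v) v := fun v => by
    rw [real_inner_comm, ← integral_inner (F.integrable_smul_gradient hf.1 hg.1 hχ v)]
    simp only [real_inner_smul_right, real_inner_comm v]
  have hint : ∀ v : E3, Integrable (fun x => tens b Q f g (gapCut k h) x * inner ℝ (G x v) v)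
      (volume.restrict Ω) := fun v => by
    simpa [real_inner_smul_left] using
      (F.integrable_smul_gradient hf.1 hg.1 hχ v).inner_const (𝕜 := ℝ) v
  have hsum : inner ℝ (∫ x in Ω, tens b Q f g (gapCut k h) x • G x (b 0)) (b 0) +
      inner ℝ (∫ x in Ω, tens b Q f g (gapCut k h) x • G x (b 1)) (b 1) +
      inner ℝ (∫ x in Ω, tens b Q f g (gapCut k h) x • G x (b 2)) (b 2) = 0 := by
    have h01 := (hint (b 0)).add (hint (b 1))
    rw [hin, hin, hin, ← integral_add (hint _) (hint _)]
    refine (integral_add h01 (hint (b 2))).symm.trans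
      (integral_eq_zero_of_ae (F.ae_trace_eq_zero.mono fun x hx => ?_))
    simp only [Pi.add_apply, Pi.zero_apply, ← mul_add]
    rw [hx, mul_zero]
  have h0 := F.memW1pZero.integral_fderiv_smul F.one_le_p (contDiff_tens b Q hf.1 hg.1 hχ)
    (hasCompactSupport_tens b Q hf.1 hg.1 hχ) (b 0)
  have h1 := F.memW1pZero.integral_fderiv_smul F.one_le_p (contDiff_tens b Q hf.1 hg.1 hχ)
    (hasCompactSupport_tens b Q hf.1 hg.1 hχ) (b 1)
  simp only [(fderiv_tens_basis b Q hf.1 hg.1 hχ _).1] at h0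
  simp only [(fderiv_tens_basis b Q hf.1 hg.1 hχ _).2.1] at h1
  -- The rigid term drops out: since `f'` has zero mean, only the moment along `ω × b₀` survives,
  -- and this is orthogonal to `b₀`. The same happens for `b₁` below.
  rw [F.integral_tens_gapCut hf.deriv hg, integral_tens_smul_affine b Q hf.1.deriv hg.1 hκ
    (fun x => rigidField_eq b uStar ω xStar x Q), hf.1.integral_deriv] at h0
  rw [F.integral_tens_gapCut hf hg.deriv, integral_tens_smul_affine b Q hf.1 hg.1.deriv hκ
    (fun x => rigidField_eq b uStar ω xStar x Q), hg.1.integral_deriv] at h1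
  have h0' := congrArg (fun v : E3 => inner ℝ v (b 0)) h0
  have h1' := congrArg (fun v : E3 => inner ℝ v (b 1)) h1
  simp only [zero_mul, mul_zero, zero_smul, add_zero, zero_add, inner_sub_left, inner_neg_left,
    real_inner_smul_left, inner_cross3_self] at h0' h1'
  rw [F.integral_layer hf hg]
  linarith

end GapFlow

/-! ### Estimates by the gradient in the fluid. -/

namespace GapFlow

variable {p k σ h : ℝ} {Ω S C : Set E3} {b : OrthonormalBasis (Fin 3) ℝ E3} {Q : E3}
    {u : E3 → E3} {G : E3 → E3 →L[ℝ] E3} {uStar ω xStar : E3} {f g w : ℝ → ℝ} {M : ℝ}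

theorem integrableOn_gradient (F : GapFlow p k σ h Ω S C b Q u G uStar ω xStar) :
    IntegrableOn G (C ∩ fluid S Ω) := by
  have : IsFiniteMeasure (volume.restrict (C ∩ fluid S Ω)) :=
    ⟨by
      rw [Measure.restrict_apply_univ]
      exact (measure_mono inter_subset_left).trans_lt F.volume_cylinder.lt_top⟩
  exact (F.memW1pZero.1.2.1.mono_measure
    (Measure.restrict_mono (fun x hx => hx.2.1) le_rfl)).integrable (by simpa using F.one_le_p)

/-- `Ω` is body plus fluid up to a null set, and on the body the derivative along the axis is the
constant `ω × b₂`. That part is kept as a separate multiple because it disappears when paired with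
`b₂`. -/
theorem exists_decomposition (F : GapFlow p k σ h Ω S C b Q u G uStar ω xStar)
    (hf : IsTestOn σ f) (hg : IsTestOn σ g) (hw : IsTest w)
    (hws : ∀ t, w t ≠ 0 → -(2 * (k * h)) < t ∧ t < h + 2 * (k * h))
    (hM : ∀ x, |tens b Q f g w x| ≤ M) :
    ∃ (s : ℝ) (E : E3), ∫ x in Ω, tens b Q f g w x • G x (b 2) = s • cross3 ω (b 2) + E ∧
      |s| ≤ M * volume.real C ∧ ‖E‖ ≤ M * ∫ x in C ∩ fluid S Ω, ‖G x‖ := by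
  have hM0 : 0 ≤ M := (abs_nonneg _).trans (hM 0)
  have hoff : ∀ x ∈ Ω, x ∉ C → tens b Q f g w x = 0 := fun x hx hxC => by
    by_contra hne
    obtain ⟨h12, h3⟩ := mul_ne_zero_iff.1 hne
    obtain ⟨h1, h2⟩ := mul_ne_zero_iff.1 h12
    exact hxC (F.mem_cylinder x hx (hf.2 _ h1) (hg.2 _ h2) (hws _ h3).1 (hws _ h3).2)
  have hSm := F.isOpen_body.measurableSet
  have hfm : MeasurableSet (fluid S Ω) :=
    F.isOpen_domain.measurableSet.diff isClosed_closure.measurableSet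
  have hint := F.integrable_smul_gradient hf.1 hg.1 hw (b 2)
  have hae : (Ω : Set E3) =ᵐ[volume] (S ∪ fluid S Ω : Set E3) := by
    have hnull : ∀ᵐ x ∂(volume : Measure E3), x ∉ frontier S :=
      measure_eq_zero_iff_ae_notMem.1 F.frontier_null
    refine eventuallyEq_set.2 (hnull.mono fun x hx => ⟨fun hxΩ => ?_, ?_⟩)
    · by_cases hxS : x ∈ closure S
      · rcases (closure_eq_self_union_frontier S ▸ hxS : x ∈ S ∪ frontier S) with h | h
        · exact Or.inl h
        · exact absurd h hx
      · exact Or.inr ⟨hxΩ, hxS⟩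
    · rintro (h | h)
      · exact F.subset h
      · exact h.1
  have hdisj : Disjoint S (fluid S Ω) :=
    Set.disjoint_left.2 fun x hx hxf => hxf.2 (subset_closure hx)
  refine ⟨∫ x in S, tens b Q f g w x, ∫ x in fluid S Ω, tens b Q f g w x • G x (b 2), ?_, ?_, ?_⟩
  · have hS : IntegrableOn (fun x => tens b Q f g w x • G x (b 2)) S :=
      hint.mono_measure (Measure.restrict_mono F.subset le_rfl)
    have hfl : IntegrableOn (fun x => tens b Q f g w x • G x (b 2)) (fluid S Ω) :=
      hint.mono_measure (Measure.restrict_mono sdiff_subset le_rfl)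
    rw [setIntegral_congr_set hae, setIntegral_union hdisj hfm hS hfl, ← integral_smul_const]
    congr 1
    refine integral_congr_ae ?_
    filter_upwards [gradient_eq_cross_of_rigid F.memW1pZero.1 F.one_le_p
      F.isOpen_domain.measurableSet F.isOpen_body F.subset F.rigid (b 2)] with x hx
    rw [hx]
  · have e : ∫ x in S, tens b Q f g w x = ∫ x in S ∩ C, tens b Q f g w x :=
      setIntegral_eq_of_subset_of_forall_sdiff_eq_zero hSm inter_subset_left
        fun x hx => hoff x (F.subset hx.1) fun hC => hx.2 ⟨hx.1, hC⟩
    have hlt : volume (S ∩ C) < ⊤ := (measure_mono inter_subset_right).trans_lt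
      F.volume_cylinder.lt_top
    rw [e, ← Real.norm_eq_abs]
    refine (norm_setIntegral_le_of_norm_le_const hlt (fun x _ => hM x)).trans ?_
    exact mul_le_mul_of_nonneg_left (measureReal_mono inter_subset_right F.volume_cylinder) hM0
  · have e : ∫ x in fluid S Ω, tens b Q f g w x • G x (b 2) =
        ∫ x in C ∩ fluid S Ω, tens b Q f g w x • G x (b 2) :=
      setIntegral_eq_of_subset_of_forall_sdiff_eq_zero hfm inter_subset_right
        fun x hx => by rw [hoff x hx.1.1 fun hC => hx.2 ⟨hC, hx.1⟩, zero_smul]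
    rw [e, ← integral_const_mul]
    refine norm_integral_le_of_norm_le (F.integrableOn_gradient.norm.const_mul M)
      (Eventually.of_forall fun x => ?_)
    rw [norm_smul]
    refine mul_le_mul (hM x) ?_ (norm_nonneg _) hM0
    simpa [b.orthonormal.1 2] using (G x).le_opNorm (b 2)

theorem norm_integral_le (F : GapFlow p k σ h Ω S C b Q u G uStar ω xStar)
    (hf : IsTestOn σ f) (hg : IsTestOn σ g) (hw : IsTest w)
    (hws : ∀ t, w t ≠ 0 → -(2 * (k * h)) < t ∧ t < h + 2 * (k * h))
    (hM : ∀ x, |tens b Q f g w x| ≤ M) :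
    ‖∫ x in Ω, tens b Q f g w x • G x (b 2)‖ ≤
      M * ((∫ x in C ∩ fluid S Ω, ‖G x‖) + volume.real C * ‖cross3 ω (b 2)‖) ∧
    |inner ℝ (∫ x in Ω, tens b Q f g w x • G x (b 2)) (b 2)| ≤
      M * ∫ x in C ∩ fluid S Ω, ‖G x‖ := by
  obtain ⟨s, E, h1, h2, h3⟩ := F.exists_decomposition hf hg hw hws hM
  rw [h1]
  constructor
  · refine (norm_add_le _ _).trans ?_
    rw [norm_smul, Real.norm_eq_abs]
    nlinarith [mul_le_mul_of_nonneg_right h2 (norm_nonneg (cross3 ω (b 2)))]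
  · rw [inner_add_left, real_inner_smul_left, inner_cross3_self, mul_zero, zero_add]
    refine (abs_real_inner_le_norm _ _).trans ?_
    rwa [b.orthonormal.1 2, mul_one]

end GapFlow

/-! ### Profiles and the bounds of the rigid motion. -/

/-- A test function supported in `[-1/2, 1/2]`, bounded by `M` with its derivative. -/
structure IsProfile (M : ℝ) (φ : ℝ → ℝ) : Prop where
  isTest : IsTest φ
  support : ∀ t, φ t ≠ 0 → |t| ≤ 1 / 2
  bound : ∀ t, |φ t| ≤ M
  deriv_bound : ∀ t, |deriv φ t| ≤ M

namespace IsProfile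

variable {M σ : ℝ} {φ : ℝ → ℝ}

theorem isTestOn (hφ : IsProfile M φ) (hσ : 0 < σ) : IsTestOn σ (fun t => φ (t / σ)) := by
  refine ⟨hφ.isTest.comp_div hσ.ne', fun t ht => ?_⟩
  have := hφ.support _ ht
  rw [abs_div, abs_of_pos hσ, div_le_iff₀ hσ] at this
  linarith

theorem deriv_comp_div (hφ : IsProfile M φ) (t : ℝ) :
    deriv (fun t => φ (t / σ)) t = deriv φ (t / σ) / σ := by
  have := ((hφ.isTest.differentiable (t / σ)).hasDerivAt.comp t
    ((hasDerivAt_id t).div_const σ)).deriv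
  simpa [Function.comp_def, div_eq_mul_inv] using this

theorem abs_deriv_comp_div_le (hφ : IsProfile M φ) (hσ : 0 < σ) (t : ℝ) :
    |deriv (fun t => φ (t / σ)) t| ≤ M / σ := by
  rw [hφ.deriv_comp_div, abs_div, abs_of_pos hσ]
  exact div_le_div_of_nonneg_right (hφ.deriv_bound _) hσ.le

theorem integral_comp_div (φ : ℝ → ℝ) (hσ : 0 < σ) : ∫ t, φ (t / σ) = σ * ∫ t, φ t := by
  rw [Measure.integral_comp_div, abs_of_pos hσ, smul_eq_mul]

theorem integral_mul_comp_div (φ : ℝ → ℝ) (hσ : 0 < σ) :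
    ∫ t, t * φ (t / σ) = σ ^ 2 * ∫ t, t * φ t := by
  have e : ∀ t, t * φ (t / σ) = σ * ((fun s => s * φ s) (t / σ)) := fun t => by
    field_simp
  simp_rw [e]
  rw [integral_const_mul, integral_comp_div (fun s => s * φ s) hσ]; ring

end IsProfile

/-- There are an even profile with positive mass and its first moment profile. -/
theorem exists_profile : ∃ (M : ℝ) (φ : ℝ → ℝ), 0 < M ∧ IsProfile M φ ∧
    IsProfile M (fun t => t * φ t) ∧ 0 < ∫ t, φ t ∧ ∫ t, t * φ t = 0 ∧
    0 < ∫ t, t * (t * φ t) := by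
  let β : ContDiffBump (0 : ℝ) := ⟨1 / 4, 1 / 2, by norm_num, by norm_num⟩
  have hβ : IsTest β := ⟨β.contDiff, β.hasCompactSupport⟩
  have hsup : ∀ t, β t ≠ 0 → |t| ≤ 1 / 2 := fun t ht => by
    have : t ∈ Function.support β := ht
    rw [β.support_eq, mem_ball_zero_iff] at this
    exact this.le
  obtain ⟨C1, h1, h1'⟩ := hβ.exists_bound
  obtain ⟨C2, h2, h2'⟩ := hβ.deriv.exists_bound
  obtain ⟨C3, h3, h3'⟩ := hβ.id_mul.exists_bound
  obtain ⟨C4, h4, h4'⟩ := hβ.id_mul.deriv.exists_bound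
  refine ⟨C1 + C2 + C3 + C4, β, by positivity, ⟨hβ, hsup, fun t => ?_, fun t => ?_⟩,
    ⟨hβ.id_mul, fun t ht => hsup t (mul_ne_zero_iff.1 ht).2, fun t => ?_, fun t => ?_⟩,
    β.integral_pos, ?_, ?_⟩
  · linarith [h1' t]
  · linarith [h2' t]
  · linarith [h3' t]
  · linarith [h4' t]
  · have := integral_neg_eq_self (fun t : ℝ => t * β t) volume
    simp only [β.neg, neg_mul, integral_neg] at this
    linarith
  · refine Continuous.integral_pos_of_hasCompactSupport_nonneg_nonzero (x := 1 / 8)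
      hβ.id_mul.id_mul.continuous hβ.id_mul.id_mul.2 (fun t => ?_) ?_
    · rw [← mul_assoc]
      exact mul_nonneg (mul_self_nonneg t) β.nonneg
    · have : β (1 / 8) = 1 := β.one_of_mem_closedBall (by
        rw [mem_closedBall_zero_iff]; norm_num)
      rw [this]; norm_num

namespace GapFlow

variable {p k σ h : ℝ} {Ω S C : Set E3} {b : OrthonormalBasis (Fin 3) ℝ E3} {Q : E3}
    {u : E3 → E3} {G : E3 → E3 →L[ℝ] E3} {uStar ω xStar : E3} {φ ψ : ℝ → ℝ} {M : ℝ}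

theorem abs_tens_le {f g w : ℝ → ℝ} {A B D : ℝ} (hf : ∀ t, |f t| ≤ A) (hg : ∀ t, |g t| ≤ B)
    (hw : ∀ t, |w t| ≤ D) (x : E3) : |tens b Q f g w x| ≤ A * B * D := by
  rw [tens, abs_mul, abs_mul]
  have hA := (abs_nonneg _).trans (hf 0)
  have hB := (abs_nonneg _).trans (hg 0)
  have := hf (b.repr (x - Q) 0)
  have := hg (b.repr (x - Q) 1)
  have := hw (b.repr (x - Q) 2)
  gcongr

theorem abs_gapCut_le (t : ℝ) : |gapCut k h t| ≤ 1 := by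
  rw [abs_of_nonneg (gapCut_nonneg t)]; exact gapCut_le_one t

theorem abs_id_mul_gapCut_le (hk : 0 < k) (hh : 0 < h) (t : ℝ) :
    |t * gapCut k h t| ≤ (1 + 2 * k) * h := by
  have hkh := mul_pos hk hh
  by_cases ht : gapCut k h t = 0
  · rw [ht, mul_zero, abs_zero]; positivity
  · obtain ⟨h1, h2⟩ := gapCut_support hk hh ht
    rw [abs_mul]
    have h3 : |t| ≤ (1 + 2 * k) * h := abs_le.2 ⟨by linarith, by linarith⟩
    have := abs_gapCut_le (k := k) (h := h) t
    nlinarith [abs_nonneg t]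

/-- The moments of the rigid motion on the layer in `S` are controlled by the gradient of the
field in the fluid part of the gap. -/
theorem moment_bounds (F : GapFlow p k σ h Ω S C b Q u G uStar ω xStar)
    (hφ : IsProfile M φ) (hψ : IsProfile M ψ) {I : E3}
    (hI : I = ∫ x, tens b Q (fun t => φ (t / σ)) (fun t => ψ (t / σ)) (layerWeight k h) x •
      rigidField uStar ω xStar x) :
    |inner ℝ I (b 2)| ≤ M ^ 2 * (∫ x in C ∩ fluid S Ω, ‖G x‖) ∧
    ‖I‖ ≤ M ^ 2 * ((∫ x in C ∩ fluid S Ω, ‖G x‖) + volume.real C * ‖cross3 ω (b 2)‖) ∧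
    |inner ℝ I (b 2)| ≤ 2 * M ^ 2 * (1 + 2 * k) * (h / σ) *
      ((∫ x in C ∩ fluid S Ω, ‖G x‖) + volume.real C * ‖cross3 ω (b 2)‖) := by
  have hσ := F.σ_pos
  have hχ := isTest_gapCut F.k_pos F.h_pos
  have hφσ := hφ.isTestOn hσ
  have hψσ := hψ.isTestOn hσ
  have hφb : ∀ t, |φ (t / σ)| ≤ M := fun t => hφ.bound _
  have hψb : ∀ t, |ψ (t / σ)| ≤ M := fun t => hψ.bound _
  have hχs : ∀ t, gapCut k h t ≠ 0 → -(2 * (k * h)) < t ∧ t < h + 2 * (k * h) :=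
    fun t => gapCut_support F.k_pos F.h_pos
  have hτs : ∀ t, t * gapCut k h t ≠ 0 → -(2 * (k * h)) < t ∧ t < h + 2 * (k * h) :=
    fun t ht => hχs t (mul_ne_zero_iff.1 ht).2
  have hτb := abs_id_mul_gapCut_le F.k_pos F.h_pos
  have h1 := F.norm_integral_le hφσ hψσ hχ hχs (M := M ^ 2) fun x =>
    (abs_tens_le hφb hψb abs_gapCut_le x).trans_eq (by ring)
  have h2 := (F.norm_integral_le hφσ.deriv hψσ hχ.id_mul hτs
    (abs_tens_le (hφ.abs_deriv_comp_div_le hσ) hψb hτb)).1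
  have h3 := (F.norm_integral_le hφσ hψσ.deriv hχ.id_mul hτs
    (abs_tens_le hφb (hψ.abs_deriv_comp_div_le hσ) hτb)).1
  have h4 := F.inner_integral_layer hφσ hψσ
  rw [← F.integral_layer hφσ hψσ, ← hI] at h1
  rw [← hI] at h4
  refine ⟨h1.2, h1.1, ?_⟩
  rw [h4]
  have hin : ∀ (v : E3) (i : Fin 3), |inner ℝ v (b i)| ≤ ‖v‖ := fun v i =>
    (abs_real_inner_le_norm _ _).trans_eq (by rw [b.orthonormal.1 i, mul_one])
  have h5 := (hin _ 0).trans h2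
  have h6 := (hin _ 1).trans h3
  rw [← abs_neg] at h5
  refine (abs_sub _ _).trans ((add_le_add h5 h6).trans_eq ?_)
  field_simp
  ring

/-- By antisymmetry, the tangential components of `ω × b₂` are, up to sign, the normal components of
`ω × b₀` and `ω × b₁`, for which the better estimate is available. -/
theorem norm_cross3_basis_two_le (b : OrthonormalBasis (Fin 3) ℝ E3) (ω : E3) :
    ‖cross3 ω (b 2)‖ ≤
      |inner ℝ (cross3 ω (b 0)) (b 2)| + |inner ℝ (cross3 ω (b 1)) (b 2)| := by
  have h3 := norm_sq_eq_sum_inner b (cross3 ω (b 2))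
  rw [inner_cross3_self, inner_cross3_comm ω (b 2) (b 0), inner_cross3_comm ω (b 2) (b 1)] at h3
  refine (sq_le_sq₀ (norm_nonneg _) (by positivity)).1 ?_
  rw [h3, add_sq, sq_abs, sq_abs, neg_sq, neg_sq]
  have := mul_nonneg (abs_nonneg (inner ℝ (cross3 ω (b 0)) (b 2)))
    (abs_nonneg (inner ℝ (cross3 ω (b 1)) (b 2)))
  linarith

/-- Here `T` is the integral of the gradient norm over the fluid gap, `V` the volume of the
cylinder, `y = |ω × b₂|`; `x₀`, `x₁` are the normal components of `ω × b₀`, `ω × b₁`; `z`, `q` are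
the size and normal component of the mean velocity on the layer, and `r = |ω × b₀|`. The hypotheses
without `V * y` give a crude bound of `y`; it makes `V * y` at most a multiple of `T`, and the
sharper hypotheses then close. -/
theorem exists_algebraic_bounds {k Λ M m₀ m₂ : ℝ} (hk : 0 < k) (hΛ : 0 < Λ) (hM : 0 < M)
    (hm0 : 0 < m₀) (hm2 : 0 < m₂) : ∃ K, 0 < K ∧ ∀ {σ h T V x₀ x₁ y z q r : ℝ},
    0 < σ → 0 < h → 0 ≤ T → 0 ≤ V → 0 ≤ y → h ≤ Λ * σ → V ≤ 4 * σ ^ 2 * ((1 + 3 * k) * h) →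
    y ≤ x₀ + x₁ → σ ^ 3 * (m₀ * m₂) * x₀ ≤ M ^ 2 * T → σ ^ 3 * (m₀ * m₂) * x₁ ≤ M ^ 2 * T →
    σ ^ 3 * (m₀ * m₂) * x₀ ≤ 2 * M ^ 2 * (1 + 2 * k) * (h / σ) * (T + V * y) →
    σ ^ 3 * (m₀ * m₂) * x₁ ≤ 2 * M ^ 2 * (1 + 2 * k) * (h / σ) * (T + V * y) →
    σ ^ 2 * m₀ ^ 2 * z ≤ M ^ 2 * (T + V * y) →
    σ ^ 2 * m₀ ^ 2 * q ≤ 2 * M ^ 2 * (1 + 2 * k) * (h / σ) * (T + V * y) →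
    σ ^ 3 * (m₀ * m₂) * r ≤ M ^ 2 * (T + V * y) →
    q ≤ K * (h / σ ^ 3 * T) ∧ z + 2 * (k * h) * y ≤ K * (1 / σ ^ 2 * T) ∧
      y ≤ K * (h / σ ^ 4 * T) ∧ r ≤ K * (1 / σ ^ 3 * T) := by
  obtain ⟨a, ha⟩ : ∃ a, a = 2 * M ^ 2 / (m₀ * m₂) := ⟨_, rfl⟩
  obtain ⟨K₁, hK₁⟩ : ∃ K₁, K₁ = 1 + 4 * (1 + 3 * k) * Λ * a := ⟨_, rfl⟩
  obtain ⟨c, hc⟩ : ∃ c, c = 2 * M ^ 2 * (1 + 2 * k) * K₁ := ⟨_, rfl⟩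
  have ha0 : 0 < a := by rw [ha]; positivity
  have hK₁0 : 0 < K₁ := by rw [hK₁]; positivity
  have hc0 : 0 < c := by rw [hc]; positivity
  have q1 : 0 < c / m₀ ^ 2 := by positivity
  have q2 : 0 < M ^ 2 * K₁ / m₀ ^ 2 + 2 * k * Λ * a := by positivity
  have q3 : 0 < 2 * c / (m₀ * m₂) := by positivity
  have q4 : 0 < M ^ 2 * K₁ / (m₀ * m₂) := by positivity
  obtain ⟨K, hK⟩ : ∃ K, K = c / m₀ ^ 2 + (M ^ 2 * K₁ / m₀ ^ 2 + 2 * k * Λ * a) +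
    2 * c / (m₀ * m₂) + M ^ 2 * K₁ / (m₀ * m₂) := ⟨_, rfl⟩
  refine ⟨K, by linarith, ?_⟩
  intro σ h T V x₀ x₁ y z q r hσ hh hT0 hV0 hy0 hhσ hV hy a1 a2 c1 c2 b0 c0 b1
  have n0 : 0 < σ ^ 2 * m₀ ^ 2 := by positivity
  have n1 : 0 < σ ^ 3 * (m₀ * m₂) := by positivity
  -- The crude bound, without the factor `h/σ` but also without the body term.
  have hya : y ≤ a * T / σ ^ 3 := by
    have h1 := mul_le_mul_of_nonneg_right hy n1.le
    have : y * (σ ^ 3 * (m₀ * m₂)) ≤ 2 * M ^ 2 * T := by linarith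
    calc y ≤ 2 * M ^ 2 * T / (σ ^ 3 * (m₀ * m₂)) := (le_div_iff₀ n1).2 this
      _ = a * T / σ ^ 3 := by rw [ha]; field_simp
  obtain ⟨W, hW⟩ : ∃ W, W = T + V * y := ⟨_, rfl⟩
  rw [← hW] at c1 c2 b0 c0 b1
  -- `V` is at most of order `σ²h`, hence of order `σ³` because `h ≤ Λσ`, which cancels the `σ³` in
  -- the crude bound. No smallness is needed.
  have hWT : W ≤ K₁ * T := by
    have h1 : V * y ≤ 4 * σ ^ 2 * ((1 + 3 * k) * (Λ * σ)) * (a * T / σ ^ 3) := by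
      have h4 : 4 * σ ^ 2 * ((1 + 3 * k) * h) ≤ 4 * σ ^ 2 * ((1 + 3 * k) * (Λ * σ)) := by gcongr
      exact mul_le_mul (hV.trans h4) hya hy0 (by positivity)
    have h2 : 4 * σ ^ 2 * ((1 + 3 * k) * (Λ * σ)) * (a * T / σ ^ 3) =
        4 * (1 + 3 * k) * Λ * a * T := by field_simp
    rw [h2] at h1
    rw [hW, hK₁, add_mul, one_mul]
    exact add_le_add le_rfl h1
  have hcW : 2 * M ^ 2 * (1 + 2 * k) * (h / σ) * W ≤ c * (h / σ) * T := by
    calc 2 * M ^ 2 * (1 + 2 * k) * (h / σ) * W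
        ≤ 2 * M ^ 2 * (1 + 2 * k) * (h / σ) * (K₁ * T) := by gcongr
      _ = c * (h / σ) * T := by rw [hc]; ring
  have hMW : M ^ 2 * W ≤ M ^ 2 * K₁ * T := by
    rw [mul_assoc]; gcongr
  have hsplit : ∀ {x y K' : ℝ}, 0 ≤ y → x ≤ K' * y → K' ≤ K → x ≤ K * y :=
    fun hy hx hK => hx.trans (mul_le_mul_of_nonneg_right hK hy)
  refine ⟨hsplit (by positivity) (K' := c / m₀ ^ 2) ?_ (by linarith),
    hsplit (by positivity) (K' := M ^ 2 * K₁ / m₀ ^ 2 + 2 * k * Λ * a) ?_ (by linarith),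
    hsplit (by positivity) (K' := 2 * c / (m₀ * m₂)) ?_ (by linarith),
    hsplit (by positivity) (K' := M ^ 2 * K₁ / (m₀ * m₂)) ?_ (by linarith)⟩
  · calc q ≤ c * (h / σ) * T / (σ ^ 2 * m₀ ^ 2) := (le_div_iff₀ n0).2 (by linarith)
      _ = _ := by field_simp
  · rw [add_mul]
    refine add_le_add ?_ ?_
    · calc z ≤ M ^ 2 * K₁ * T / (σ ^ 2 * m₀ ^ 2) := (le_div_iff₀ n0).2 (by linarith)
        _ = _ := by field_simp
    · calc 2 * (k * h) * y ≤ 2 * (k * (Λ * σ)) * (a * T / σ ^ 3) := by gcongr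
        _ = _ := by field_simp
  · have h1 := mul_le_mul_of_nonneg_right hy n1.le
    have : y * (σ ^ 3 * (m₀ * m₂)) ≤ 2 * (c * (h / σ) * T) := by linarith
    calc y ≤ 2 * (c * (h / σ) * T) / (σ ^ 3 * (m₀ * m₂)) := (le_div_iff₀ n1).2 this
      _ = _ := by field_simp
  · calc r ≤ M ^ 2 * K₁ * T / (σ ^ 3 * (m₀ * m₂)) := (le_div_iff₀ n1).2 (by linarith)
      _ = _ := by field_simp

/-- The moments of the rigid motion against an even profile and its first moment. -/
theorem layer_moments (F : GapFlow p k σ h Ω S C b Q u G uStar ω xStar)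
    (hφ : IsProfile M φ) (hψ : IsProfile M (fun t => t * φ t)) (hm1 : ∫ t, t * φ t = 0) :
    ∫ x, tens b Q (fun t => φ (t / σ)) (fun t => φ (t / σ)) (layerWeight k h) x •
        rigidField uStar ω xStar x =
      (σ ^ 2 * (∫ t, φ t) ^ 2) • (rigidField uStar ω xStar Q +
        (∫ t, t * layerWeight k h t) • cross3 ω (b 2)) ∧
    ∫ x, tens b Q (fun t => (fun t => t * φ t) (t / σ)) (fun t => φ (t / σ)) (layerWeight k h) x •
        rigidField uStar ω xStar x =
      (σ ^ 3 * ((∫ t, φ t) * ∫ t, t * (t * φ t))) • cross3 ω (b 0) ∧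
    ∫ x, tens b Q (fun t => φ (t / σ)) (fun t => (fun t => t * φ t) (t / σ)) (layerWeight k h) x •
        rigidField uStar ω xStar x =
      (σ ^ 3 * ((∫ t, φ t) * ∫ t, t * (t * φ t))) • cross3 ω (b 1) := by
  have hσ := F.σ_pos
  have hκ1 := integral_layerWeight F.k_pos F.h_pos
  have hκ := isTest_layerWeight F.k_pos F.h_pos
  have i0 := IsProfile.integral_comp_div φ hσ
  have i1 := IsProfile.integral_mul_comp_div φ hσ
  have j0 := IsProfile.integral_comp_div (fun t => t * φ t) hσ
  have j1 := IsProfile.integral_mul_comp_div (fun t => t * φ t) hσ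
  rw [hm1, mul_zero] at i1 j0
  have hr := fun x => rigidField_eq b uStar ω xStar x Q
  refine ⟨?_, ?_, ?_⟩
  · rw [integral_tens_smul_affine b Q (hφ.isTestOn hσ).1 (hφ.isTestOn hσ).1 hκ hr, i0, i1, hκ1]
    module
  · rw [integral_tens_smul_affine b Q (hψ.isTestOn hσ).1 (hφ.isTestOn hσ).1 hκ hr, i0, i1, j0, j1,
      hκ1]
    module
  · rw [integral_tens_smul_affine b Q (hφ.isTestOn hσ).1 (hψ.isTestOn hσ).1 hκ hr, i0, i1, j0, j1,
      hκ1]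
    module

/-- Bounds of the rigid motion in terms of the `L¹` norm of the gradient in the gap. -/
theorem exists_rigid_bounds {k Λ : ℝ} (hk : 0 < k) (hΛ : 0 < Λ) : ∃ K, 0 < K ∧
    ∀ {p σ h : ℝ} {Ω S C : Set E3} {b : OrthonormalBasis (Fin 3) ℝ E3} {Q : E3}
    {u : E3 → E3} {G : E3 → E3 →L[ℝ] E3} {uStar ω xStar : E3},
    GapFlow p k σ h Ω S C b Q u G uStar ω xStar → h ≤ Λ * σ →
    volume.real C ≤ 4 * σ ^ 2 * ((1 + 3 * k) * h) →
    |inner ℝ (rigidField uStar ω xStar (Q + h • b 2)) (b 2)| ≤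
      K * (h / σ ^ 3 * ∫ x in C ∩ fluid S Ω, ‖G x‖) ∧
    ‖rigidField uStar ω xStar (Q + h • b 2)‖ ≤
      K * (1 / σ ^ 2 * ∫ x in C ∩ fluid S Ω, ‖G x‖) ∧
    ‖cross3 ω (b 2)‖ ≤ K * (h / σ ^ 4 * ∫ x in C ∩ fluid S Ω, ‖G x‖) ∧
    |inner ℝ (cross3 ω (b 0)) (b 1)| ≤ K * (1 / σ ^ 3 * ∫ x in C ∩ fluid S Ω, ‖G x‖) := by
  obtain ⟨M, φ, hM, hφ, hψ, hm0, hm1, hm2⟩ := exists_profile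
  obtain ⟨K, hK, hbound⟩ := exists_algebraic_bounds hk hΛ hM hm0 hm2
  refine ⟨K, hK, ?_⟩
  intro p σ h Ω S C b Q u G uStar ω xStar F hhσ hV
  have hσ := F.σ_pos
  obtain ⟨I0, I1, I2⟩ := F.layer_moments hφ hψ hm1
  obtain ⟨-, b0, c0⟩ := F.moment_bounds hφ hφ I0.symm
  obtain ⟨a1, b1, c1⟩ := F.moment_bounds hψ hφ I1.symm
  obtain ⟨a2, -, c2⟩ := F.moment_bounds hφ hψ I2.symm
  have n0 : 0 < σ ^ 2 * (∫ t, φ t) ^ 2 := by positivity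
  have n1 : 0 < σ ^ 3 * ((∫ t, φ t) * ∫ t, t * (t * φ t)) := by positivity
  rw [real_inner_smul_left, abs_mul, abs_of_pos n1] at a1 a2 c1 c2
  rw [real_inner_smul_left, abs_mul, abs_of_pos n0] at c0
  rw [norm_smul, Real.norm_of_nonneg n0.le] at b0
  rw [norm_smul, Real.norm_of_nonneg n1.le] at b1
  have hT0 : 0 ≤ ∫ x in C ∩ fluid S Ω, ‖G x‖ := integral_nonneg fun _ => norm_nonneg _
  obtain ⟨d1, d2, d3, d4⟩ := hbound hσ F.h_pos hT0 measureReal_nonneg (norm_nonneg _) hhσ hV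
    (norm_cross3_basis_two_le b ω) a1 a2 c1 c2 b0 c0 b1
  have hmh := abs_integral_layerWeight_sub_le (k := k) F.k_pos F.h_pos
  have hP : rigidField uStar ω xStar (Q + h • b 2) =
      rigidField uStar ω xStar Q + h • cross3 ω (b 2) := by
    simp only [rigidField, ← crossCLM_apply, ← map_smul, add_assoc, ← map_add]
    congr 2; abel
  refine ⟨?_, le_trans ?_ d2, d3, le_trans ?_ d4⟩
  · rw [inner_add_left, real_inner_smul_left, inner_cross3_self, mul_zero, add_zero] at d1
    rwa [hP, inner_add_left, real_inner_smul_left, inner_cross3_self, mul_zero, add_zero]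
  -- The velocity at `P` is the layer mean up to a multiple of `ω × b₂` of size at most `2kh`; the
  -- summand `2 * (k * h) * y` of the algebraic bound is reserved for it.
  · have h5 : rigidField uStar ω xStar Q + h • cross3 ω (b 2) =
        (rigidField uStar ω xStar Q + (∫ t, t * layerWeight k h t) • cross3 ω (b 2)) -
          ((∫ t, t * layerWeight k h t) - h) • cross3 ω (b 2) := by module
    rw [hP, h5]
    refine (norm_sub_le _ _).trans (add_le_add le_rfl ?_)
    rw [norm_smul, Real.norm_eq_abs]
    exact mul_le_mul_of_nonneg_right hmh (norm_nonneg _)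
  · exact (abs_real_inner_le_norm _ _).trans_eq (by rw [b.orthonormal.1 1, mul_one])

end GapFlow

/-! ### Coordinates adapted to the axis and the volume of the cylinder. -/

section Coordinates

variable {α k σ : ℝ} {P Q : E3} {b : OrthonormalBasis (Fin 3) ℝ E3}

theorem exists_basis_axis {n : E3} (hn : ‖n‖ = 1) :
    ∃ b : OrthonormalBasis (Fin 3) ℝ E3, b 2 = n := by
  have hv : Orthonormal ℝ (({2} : Set (Fin 3)).domRestrict fun _ => n) :=
    ⟨fun _ => hn, fun i j hij => absurd (Subsingleton.elim i j) hij⟩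
  obtain ⟨b, hb⟩ := hv.exists_orthonormalBasis_extension_of_card_eq (by simp)
  exact ⟨b, hb 2 rfl⟩

theorem normalPart_eq_repr (hb : b 2 = axis P Q) (v : E3) : normalPart P Q v = b.repr v 2 := by
  rw [normalPart, ← hb, b.repr_apply_apply, real_inner_comm]

theorem norm_tangentPart_sq (hb : b 2 = axis P Q) (v : E3) :
    ‖tangentPart P Q v‖ ^ 2 = b.repr v 0 ^ 2 + b.repr v 1 ^ 2 := by
  rw [norm_sq_eq_sum_inner b, tangentPart, normalPart, ← hb]
  simp only [inner_sub_left, real_inner_smul_left, b.inner_eq_ite, b.repr_apply_apply,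
    real_inner_comm v]
  simp

theorem norm_tangentPart_le (hb : b 2 = axis P Q) (v : E3) : ‖tangentPart P Q v‖ ≤ ‖v‖ := by
  refine (sq_le_sq₀ (norm_nonneg _) (norm_nonneg _)).1 ?_
  rw [norm_tangentPart_sq hb, norm_sq_eq_sum_inner b v]
  simp only [b.repr_apply_apply, real_inner_comm]
  nlinarith [sq_nonneg (inner ℝ v (b 2))]

theorem norm_tangentPart_eq_norm_cross3 (hb : b 2 = axis P Q) (v : E3) :
    ‖tangentPart P Q v‖ = ‖cross3 v (b 2)‖ := by
  refine (sq_eq_sq₀ (norm_nonneg _) (norm_nonneg _)).1 ?_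
  rw [norm_tangentPart_sq hb, norm_cross3_basis_sq, norm_sq_eq_sum_inner b v]
  simp only [b.repr_apply_apply, real_inner_comm]
  ring

/-- The square of half-side `σ/2` lies in the disc of radius `σ`, as its half-diagonal is `σ/√2`. -/
theorem norm_tangentPart_lt (hσ : 0 < σ) (hb : b 2 = axis P Q) {v : E3}
    (h0 : |b.repr v 0| ≤ σ / 2) (h1 : |b.repr v 1| ≤ σ / 2) : ‖tangentPart P Q v‖ < σ := by
  refine (sq_lt_sq₀ (norm_nonneg _) hσ.le).1 ?_
  rw [norm_tangentPart_sq hb]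
  have e0 := sq_le_sq' (by linarith [(abs_le.1 h0).1]) (abs_le.1 h0).2
  have e1 := sq_le_sq' (by linarith [(abs_le.1 h1).1]) (abs_le.1 h1).2
  nlinarith

theorem measurableSet_gapCylinder : MeasurableSet (gapCylinder α k σ P Q) := by
  have hn : Continuous fun x => normalPart P Q (x - Q) := by unfold normalPart; fun_prop
  have ht : Continuous fun x => ‖tangentPart P Q (x - Q)‖ := by
    unfold tangentPart normalPart; fun_prop
  exact ((isOpen_lt ht continuous_const).inter ((isOpen_lt continuous_const hn).inter
    (isOpen_lt hn continuous_const))).measurableSet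

theorem volume_gapCylinder_le (hσ : 0 < σ) (hb : b 2 = axis P Q) :
    volume (gapCylinder α k σ P Q) ≤
      ENNReal.ofReal (4 * σ ^ 2 * (dist P Q + 3 * (k * σ ^ (1 + α)))) := by
  have e : dist P Q + 3 * (k * σ ^ (1 + α)) =
      dist P Q + 2 * k * σ ^ (1 + α) - -(k * σ ^ (1 + α)) := by ring
  rw [e, ← volume_coord_box b Q hσ]
  refine measure_mono fun x hx => ?_
  obtain ⟨h1, h2, h3⟩ := hx
  rw [normalPart_eq_repr hb] at h2 h3
  have h4 := pow_lt_pow_left₀ h1 (norm_nonneg _) two_ne_zero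
  rw [norm_tangentPart_sq hb] at h4
  exact ⟨abs_lt_of_sq_lt_sq (by nlinarith [sq_nonneg (b.repr (x - Q) 1)]) hσ.le,
    abs_lt_of_sq_lt_sq (by nlinarith [sq_nonneg (b.repr (x - Q) 0)]) hσ.le, h2, h3⟩

end Coordinates

/-! ### Passage from the domains to the gap and the final powers of `h`. -/

/-- Since `σ^{1+α} = h`, both boundaries deviate by less than `kh` from their tangent planes over
the disc of radius `σ`. The condition `2h < σ₀^{1+α}` keeps the layers, up to `2kh` away from these
planes, in the range where the boundaries are controlled. -/
theorem gapFlow_of_domains {α p k σ₀ σ h : ℝ} (hα : 0 < α) (hp : 1 ≤ p) (hk : 0 < k)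
    (hσ₀ : 0 < σ₀) {Ω S : Set E3} (hΩ : UniformlyC1α α k σ₀ Ω) (hS : UniformlyC1α α k σ₀ S)
    (hSΩ : S ⊆ Ω) {P Q : E3} (hP : P ∈ frontier S) (hQ : Q ∈ frontier Ω)
    (hh : h = bodyDist S Ω) (hPQ : dist P Q = h) (h0 : 0 < h) (hσ : 0 < σ) (hσσ₀ : σ < σ₀)
    (hσh : σ ^ (1 + α) = h) (hlt : 2 * h < σ₀ ^ (1 + α))
    {u : E3 → E3} {G : E3 → E3 →L[ℝ] E3} {uStar ω xStar : E3}
    (hu : MemW1pZeroRigid p S Ω u G uStar ω xStar) (hdiv : DivFree Ω G)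
    {b : OrthonormalBasis (Fin 3) ℝ E3} (hb : b 2 = axis P Q) :
    GapFlow p k σ h Ω S (gapCylinder α k σ P Q) b Q u G uStar ω xStar := by
  have hd : 0 < dist P Q := hPQ ▸ h0
  have hNΩ := isC1αNormal_domain hΩ hα hk hσ₀ hSΩ hP hQ (hPQ.trans hh) hd
  have hNS := isC1αNormal_body hS hα hk hσ₀ hP hQ (hPQ.trans hh) hd
  have hkh := mul_pos hk h0
  have hklt : 2 * (k * h) < k * σ₀ ^ (1 + α) := by nlinarith
  have hbot : ∀ x, |b.repr (x - Q) 0| ≤ σ / 2 → |b.repr (x - Q) 1| ≤ σ / 2 →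
      -(2 * (k * h)) ≤ b.repr (x - Q) 2 → b.repr (x - Q) 2 ≤ -(k * h) → x ∉ Ω := by
    intro x h1 h2 h3 h4
    refine notMem_of_normalPart_le hNΩ hα hk hσσ₀ (norm_tangentPart_lt hσ hb h1 h2) ?_ ?_ <;>
      rw [normalPart_eq_repr hb]
    · linarith
    · rwa [hσh]
  refine ⟨hp, hk, hσ, h0, hΩ.1.1, hS.1.1, hSΩ, hS.volume_frontier hα hk hσ₀, hbot, ?_, ?_,
    measurableSet_gapCylinder,
    ((volume_gapCylinder_le hσ hb).trans_lt ENNReal.ofReal_lt_top).ne, hu.1, hu.2.2, hdiv⟩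
  · intro x h1 h2 h3 h4
    refine mem_of_le_normalPart hNS hd hα hk hσσ₀ (norm_tangentPart_lt hσ hb h1 h2) ?_ ?_ <;>
      rw [normalPart_eq_repr hb, hPQ]
    · rwa [hσh]
    · linarith
  · intro x hx h1 h2 h3 h4
    refine ⟨norm_tangentPart_lt hσ hb h1 h2, ?_, ?_⟩ <;> rw [normalPart_eq_repr hb, hσh]
    · by_contra! hle
      exact hbot x h1 h2 h3.le hle hx
    · rw [hPQ]; linarith

theorem integral_norm_le_LpNormOn {p V : ℝ} (hp : 1 ≤ p) (hV : 0 ≤ V) {A : Set E3}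
    {G : E3 → E3 →L[ℝ] E3} (hA : volume A ≤ ENNReal.ofReal V)
    (hG : MemLp G (ENNReal.ofReal p) (volume.restrict A)) :
    ∫ x in A, ‖G x‖ ≤ V ^ (1 - 1 / p) * LpNormOn p A G := by
  have hp0 : 0 < p := by linarith
  have hexp : 0 ≤ 1 - 1 / p := by rw [sub_nonneg, div_le_one hp0]; exact hp
  have h1 := eLpNorm_le_eLpNorm_mul_rpow_measure_univ (μ := volume.restrict A)
    (show (1 : ENNReal) ≤ ENNReal.ofReal p by simpa using hp) hG.1
  rw [Measure.restrict_apply_univ, ENNReal.toReal_one, ENNReal.toReal_ofReal hp0.le, one_div_one]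
    at h1
  have h2 : eLpNorm G 1 (volume.restrict A) ≤
      eLpNorm G (ENNReal.ofReal p) (volume.restrict A) * ENNReal.ofReal V ^ (1 - 1 / p) :=
    h1.trans (by gcongr)
  have h3 := ENNReal.toReal_mono (ENNReal.mul_ne_top hG.2.ne
    (ENNReal.rpow_ne_top_of_nonneg hexp ENNReal.ofReal_ne_top)) h2
  rw [ENNReal.toReal_mul, ← ENNReal.toReal_rpow, ENNReal.toReal_ofReal hV, mul_comm] at h3
  refine le_trans (le_of_eq ?_) h3
  rw [integral_norm_eq_lintegral_enorm hG.1, eLpNorm_one_eq_lintegral_enorm]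

theorem theorem1p1 (α p k σ₀ H : ℝ) (hα : 0 < α) (hα1 : α ≤ 1) (hp : 1 ≤ p)
    (hk : 0 < k) (hσ₀ : 0 < σ₀) (hH : 0 < H) :
    ∃ Hs Cw c₀ : ℝ, 0 < Hs ∧ 0 < Cw ∧ 0 < c₀ ∧
      ∀ (Ω S : Set E3), UniformlyC1α α k σ₀ Ω → UniformlyC1α α k σ₀ S →
        Bornology.IsBounded S → S ⊆ Ω → Metric.diam S = H →
      ∀ (P Q : E3) (h : ℝ), P ∈ frontier S → Q ∈ frontier Ω → h = bodyDist S Ω →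
        dist P Q = h → 0 < h → h < Hs →
      ∀ (u : E3 → E3) (G : E3 → E3 →L[ℝ] E3) (uStar ω xStar : E3),
        MemW1pZeroRigid p S Ω u G uStar ω xStar → DivFree Ω G →
        |normalPart P Q (rigidField uStar ω xStar P)| ≤
            Cw * h ^ ((1 + 2 * α) / (p * (1 + α)) * (p - (3 + α) / (1 + 2 * α))) *
              LpNormOn p (gapCylinder α k (c₀ * h ^ (1 / (1 + α))) P Q ∩ fluid S Ω) G ∧
        ‖tangentPart P Q (rigidField uStar ω xStar P)‖ ≤
            Cw * h ^ (1 / p * (p - (3 + α) / (1 + α))) *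
              LpNormOn p (gapCylinder α k (c₀ * h ^ (1 / (1 + α))) P Q ∩ fluid S Ω) G ∧
        ‖tangentPart P Q ω‖ ≤
            Cw * h ^ (2 * α / (p * (1 + α)) * (p - (3 + α) / (2 * α))) *
              LpNormOn p (gapCylinder α k (c₀ * h ^ (1 / (1 + α))) P Q ∩ fluid S Ω) G ∧
        |normalPart P Q ω| ≤
            Cw * h ^ (α / (p * (1 + α)) * (p - (3 + α) / α)) *
              LpNormOn p (gapCylinder α k (c₀ * h ^ (1 / (1 + α))) P Q ∩ fluid S Ω) G := by
  have hα' : 0 < 1 + α := by linarith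
  have hp0 : 0 < p := by linarith
  obtain ⟨K, hK, hbound⟩ := GapFlow.exists_rigid_bounds hk (Real.rpow_pos_of_pos hσ₀ α)
  have hD : 1 ≤ 4 * (1 + 3 * k) := by linarith
  -- The threshold on `h` yields both `σ < σ₀` and `2h < σ₀^{1+α}`. The factor `4(1 + 3k)` comes
  -- from the volume bound `4(1 + 3k)σ²h`; being at least `1`, it dominates its own power `1 - 1/p`.
  refine ⟨σ₀ ^ (1 + α) / 2, K * (4 * (1 + 3 * k)), 1, by positivity, by positivity, one_pos, ?_⟩
  intro Ω S hΩ hS _ hSΩ _ P Q h hP hQ hh hPQ h0 hlt u G uStar ω xStar hu hdiv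
  rw [one_mul]
  obtain ⟨σ, hσdef⟩ : ∃ σ, σ = h ^ (1 / (1 + α)) := ⟨_, rfl⟩
  rw [← hσdef]
  have hσ : 0 < σ := hσdef ▸ Real.rpow_pos_of_pos h0 _
  have hσh : σ ^ (1 + α) = h := by
    rw [hσdef, ← Real.rpow_mul h0.le, one_div_mul_cancel hα'.ne', Real.rpow_one]
  have hσσ₀ : σ < σ₀ := by
    rw [← Real.rpow_lt_rpow_iff hσ.le hσ₀.le hα', hσh]; linarith
  have hhσ : h ≤ σ₀ ^ α * σ := by
    rw [← hσh, add_comm, Real.rpow_add hσ, Real.rpow_one]; gcongr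
  obtain ⟨b, hb⟩ := exists_basis_axis (norm_axis (hPQ ▸ h0 : 0 < dist P Q))
  have F := gapFlow_of_domains hα hp hk hσ₀ hΩ hS hSΩ hP hQ hh hPQ h0 hσ hσσ₀ hσh
    (by linarith) hu hdiv hb
  have hvol := volume_gapCylinder_le (α := α) (k := k) hσ hb
  rw [hσh, hPQ, show h + 3 * (k * h) = (1 + 3 * k) * h by ring] at hvol
  have hV0 : 0 ≤ 4 * σ ^ 2 * ((1 + 3 * k) * h) := by positivity
  obtain ⟨B1, B2, B3, B4⟩ := hbound F hhσ (ENNReal.toReal_le_of_le_ofReal hV0 hvol)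
  have hQP : Q + h • b 2 = P := by
    rw [hb, ← hPQ, dist_smul_axis (hPQ ▸ h0), add_sub_cancel]
  rw [hQP] at B1 B2
  have hT := integral_norm_le_LpNormOn hp hV0 ((measure_mono inter_subset_left).trans hvol)
    (hu.1.1.2.1.mono_measure (Measure.restrict_mono
      (fun x (hx : x ∈ gapCylinder α k σ P Q ∩ fluid S Ω) => hx.2.1) le_rfl))
  obtain ⟨L, hL⟩ : ∃ L, L = LpNormOn p (gapCylinder α k σ P Q ∩ fluid S Ω) G := ⟨_, rfl⟩
  obtain ⟨T, hTd⟩ : ∃ T, T = ∫ x in gapCylinder α k σ P Q ∩ fluid S Ω, ‖G x‖ := ⟨_, rfl⟩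
  have hL0 : 0 ≤ L := hL ▸ ENNReal.toReal_nonneg
  rw [← hTd] at B1 B2 B3 B4 hT
  rw [← hL] at hT ⊢
  have hpow : ∀ n : ℕ, σ ^ n = h ^ (n / (1 + α)) := fun n => by
    rw [hσdef, ← Real.rpow_natCast, ← Real.rpow_mul h0.le]; congr 1; ring
  have hexp : 0 ≤ 1 - 1 / p := by rw [sub_nonneg, div_le_one hp0]; exact hp
  have hT' : T ≤ 4 * (1 + 3 * k) * h ^ ((3 + α) / (1 + α) * (1 - 1 / p)) * L := by
    refine hT.trans (mul_le_mul_of_nonneg_right ?_ hL0)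
    have e : 4 * σ ^ 2 * ((1 + 3 * k) * h) = 4 * (1 + 3 * k) * h ^ ((3 + α) / (1 + α)) := by
      rw [show (3 + α) / (1 + α) = (2 : ℕ) / (1 + α) + 1 by field_simp; push_cast; ring,
        Real.rpow_add h0, Real.rpow_one, ← hpow]
      ring
    rw [e, Real.mul_rpow (by positivity) (by positivity), ← Real.rpow_mul h0.le]
    refine mul_le_mul_of_nonneg_right ?_ (by positivity)
    refine (Real.rpow_le_rpow_of_exponent_le hD ?_).trans_eq (Real.rpow_one _)
    have : 0 ≤ 1 / p := by positivity
    linarith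
  -- Each rate is a power `h^e`; Hölder adds `(1 - 1/p)(3 + α)/(1 + α)` to the exponent, because
  -- `σ²h = h^{(3+α)/(1+α)}`.
  have key : ∀ {x c : ℝ} (e e' : ℝ), c = h ^ e → e + (3 + α) / (1 + α) * (1 - 1 / p) = e' →
      x ≤ K * (c * T) → x ≤ K * (4 * (1 + 3 * k)) * h ^ e' * L := by
    intro x c e e' hc he hx
    calc x ≤ K * (h ^ e * T) := hc ▸ hx
      _ ≤ K * (h ^ e * (4 * (1 + 3 * k) * h ^ ((3 + α) / (1 + α) * (1 - 1 / p)) * L)) := by gcongr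
      _ = K * (4 * (1 + 3 * k)) * (h ^ e * h ^ ((3 + α) / (1 + α) * (1 - 1 / p))) * L := by ring
      _ = _ := by rw [← Real.rpow_add h0, he]
  refine ⟨key (1 - (3 : ℕ) / (1 + α)) _ ?_ ?_ ((le_of_eq ?_).trans B1),
    key (0 - (2 : ℕ) / (1 + α)) _ ?_ ?_ ((norm_tangentPart_le hb _).trans B2),
    key (1 - (4 : ℕ) / (1 + α)) _ ?_ ?_ ((norm_tangentPart_eq_norm_cross3 hb ω).le.trans B3),
    key (0 - (3 : ℕ) / (1 + α)) _ ?_ ?_ ((le_of_eq ?_).trans B4)⟩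
  · rw [Real.rpow_sub h0, Real.rpow_one, hpow]
  · field_simp; push_cast; ring
  · rw [normalPart, hb]
  · rw [Real.rpow_sub h0, Real.rpow_zero, hpow]
  · field_simp; push_cast; ring
  · rw [Real.rpow_sub h0, Real.rpow_one, hpow]
  · field_simp; push_cast; ring
  · rw [Real.rpow_sub h0, Real.rpow_zero, hpow]
  · field_simp; push_cast; ring
  · rw [normalPart, ← hb, abs_inner_cross3_basis]
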